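/- Fix a field $\mathbb k$ and a small category $C$. Let $\mathbb S C$ be the free symmetric monoidal category on $C$: its objects are finite lists $(c_1\cdots c_n)$ of objects of $C$, and a morphism $(c_1\cdots c_n)\to(d_1\cdots d_n)$ is $(\sigma\,f_1\cdots f_n)$ with $\sigma\in\Sigma_n$ and $f_i\colon c_i\to d_{\sigma(i)}$ in $C$. A $C$-collection is a functor $P\colon(\mathbb S C)^{op}\times C\to \mathit{Vect}_{\mathbb k}$. A (non-unital) $C$-operad is a $C$-collection $P$ with natural transformations $\circ_i\colon P_n\otimes_i P_m\to P_{n+m-1}$ ($n\ge 1$, $m\ge 0$, $1\le i\le n$), where $P_n\otimes_iP_m=\int^{c\in C}P_n(\cdots c\cdots;-)\otimes P_m(-;c)$ is the coend over the $i$-th input of $P_n$ and the output of $P_m$, satisfying the equivariance axiom $\circ_i\cdot((-)\sigma\otimes(-)\tau)=(-)(\sigma\circ_i\tau)\cdot\circ_{\sigma(i)}$ and the sequential and parallel associativity axioms of partial compositions. Morphisms of $C$-operads are natural transformations of collections that preserve the $\circ_i$. For $f\colon d\to c_i$ in $C$ write $\circ_i^f$ for the map $P(c_1\cdots c_n;c)\otimes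 P(d_1\cdots d_m;d)\to P(c_1\cdots d_1\cdots d_m\cdots c_n;c)$, $\alpha\otimes\beta\mapsto\alpha\circ_i P(1\cdots1;f)(\beta)$. An algebra of a $C$-operad $P$ is a functor $A\colon C\to\mathit{Vect}_{\mathbb k}$ with a morphism of $C$-operads $P\to \mathit{End}_A$, where $\mathit{End}_A(c_1\cdots c_n;c)=\mathrm{Hom}(A(c_1)\otimes\cdots\otimes A(c_n),A(c))$; morphisms of algebras are natural transformations commuting with all operations. A $C$-operad is binary quadratic if it is isomorphic to $F(X)/(R)$, where $F(X)$ is the free $C$-operad on a non-symmetric $C$-collection $X=\{X_n\colon (C^{op})^n\times C\to\mathit{Vect}_{\mathbb k}\}_{n\ge 0}$ with $X_n=0$ for $n\neq2$, and $(R)$ is the operadic ideal generated by a family $R$ of operations of weight $2$ (linear combinations of composites of two generators). All these notions apply to every small category in place of $C$, in particular to the category of bouquets $$Bq^\Sigma(C)=\coprod_{n\in\mathbb N}\big((C^{op})^{n}\rtimes\Sigma_n\big)\times C=(\mathbb S C)^{op}\times C.$$ Let $\mathbb H_C$ be the following $Bq^\Sigma(C)$-operad. Take the symbols $$*_i^f\in\mathbb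 H_C\big((c_1\cdots c_n;c)\ (d_1\cdots d_m;d);(c_1\cdots c_{i-1}\,d_1\cdots d_m\,c_{i+1}\cdots c_n;c)\big),\qquad n\ge1,\ m\ge0,\ 1\le i\le n,\ f\colon d\to c_i,$$ with free actions of the morphisms of $Bq^\Sigma(C)$ on the two inputs and on the output (the left Kan extension, along the inclusion of the discrete category of objects, of the collection of vector spaces spanned by the symbols). Let $Q$ be its quotient by the $C$-equivariance relations: for $\Phi=(\sigma\,f_1\cdots f_n;f)\colon(d_1\cdots d_n;d)\to(c_1\cdots c_n;c)$ and $\Psi=(\tau\,g_1\cdots g_m;g)\colon(b_1\cdots b_m;b)\to(a_1\cdots a_m;a)$ in $Bq^\Sigma(C)$ and $h\colon a\to c_i$ in $C$, the symbol $*_i^h$ acted on by $\Phi$ and $\Psi$ at its inputs is identified with $*_{\sigma(i)}^{f_ihg}$ acted on by $((\sigma\circ_i\tau)\,f_1\cdots g_1\cdots g_m\cdots f_n;f)$ at its output. Then $\mathbb H_C=F(Q)/(\mathit{As})$, where $F(Q)$ is the free operad on $Q$ and $\mathit{As}$ consists of the $C$-associativity relations, that is, the elements $$*_{i}^g\circ_1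 *_j^f-\tau\,(*_{j+k-1}^f\circ_1 *_i^g)\ (i<j),\qquad *_i^g\circ_1 *_j^f-*_j^f\circ_2 *_{i-j+1}^g\ (j\le i<j+m),\qquad *_i^g\circ_1 *_j^f-\tau\,(*_j^f\circ_1 *_{i-m+1}^g)\ (j+m\le i\le n+m-1),$$ where $1\le j\le n$, $m,k\ge0$, for bouquets with $n$, $m$ and $k$ inputs, and $\tau$ swaps the second and the third input. Then $\mathbb H_C$ is a binary quadratic $Bq^\Sigma(C)$-operad, and its category of algebras is isomorphic (by mutually inverse functors) to the category of non-unital $C$-operads in $\mathit{Vect}_{\mathbb k}$, compatibly with the forgetful functors of both categories to the category of functors $Bq^\Sigma(C)\to\mathit{Vect}_{\mathbb k}$. -/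

import Mathlib

open CategoryTheory Opposite

universe u

namespace CatOperad

/-- Objects of the free symmetric monoidal category `𝕊 C`: finite lists of objects of `C`. -/
structure SMon (C : Type u) : Type u where
  len : ℕ
  col : Fin len → C

namespace SMon

section Category

variable {C : Type u} [SmallCategory C]

/-- Morphisms `(σ, f₁ … fₙ)` of `𝕊 C`: a bijection `σ` of positions and morphisms
`fᵢ : cᵢ ⟶ d_{σ i}` of `C`. -/
@[ext]
structure Hom (c d : SMon C) : Type u where
  perm : Fin c.len ≃ Fin d.len
  app : ∀ i, c.col i ⟶ d.col (perm i)

instance : SmallCategory (SMon C) where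
  Hom := Hom
  id c := ⟨Equiv.refl _, fun i => 𝟙 (c.col i)⟩
  comp φ ψ := ⟨φ.perm.trans ψ.perm, fun i => φ.app i ≫ ψ.app (φ.perm i)⟩
  id_comp φ := congrArg (Hom.mk φ.perm) (funext fun i => Category.id_comp (φ.app i))
  comp_id φ := congrArg (Hom.mk φ.perm) (funext fun i => Category.comp_id (φ.app i))
  assoc φ ψ χ := congrArg (Hom.mk ((φ.perm.trans ψ.perm).trans χ.perm))
    (funext fun i => Category.assoc (φ.app i) (ψ.app (φ.perm i)) (χ.app (ψ.perm (φ.perm i))))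

/-- The underlying bijection of positions of a morphism of `𝕊 C`. -/
def perm {c d : SMon C} (φ : c ⟶ d) : Fin c.len ≃ Fin d.len := Hom.perm φ

/-- The `i`-th component `cᵢ ⟶ d_{σ i}` of a morphism of `𝕊 C`. -/
def app {c d : SMon C} (φ : c ⟶ d) (i : Fin c.len) : c.col i ⟶ d.col (perm φ i) := Hom.app φ i

/-- The morphism `(1, f₁ … fₙ)` of `𝕊 C`. -/
def ofPi {n : ℕ} {c d : Fin n → C} (f : ∀ i, c i ⟶ d i) : SMon.mk n c ⟶ SMon.mk n d :=
  Hom.mk (Equiv.refl _) f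

/-- The morphism `(σ, 1 … 1) : (c_{σ 1} … c_{σ n}) ⟶ (c₁ … cₙ)` of `𝕊 C`. -/
def ofPerm {n : ℕ} (σ : Equiv.Perm (Fin n)) (c : Fin n → C) :
    SMon.mk n (fun i => c (σ i)) ⟶ SMon.mk n c :=
  Hom.mk σ fun i => 𝟙 (c (σ i))

end Category

/-! ### Positions in a substituted list -/

/-- When the `j`-th entry of a list of length `n` is replaced by a list of length `m`, this is the
new position of the `i`-th entry of the old list, `i ≠ j`. -/
def outerIdx {n : ℕ} (m : ℕ) (j i : Fin n) (h : i ≠ j) : Fin (n + m - 1) :=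
  if hlt : i.1 < j.1 then ⟨i, by omega⟩
  else ⟨i + m - 1, by have := Fin.val_ne_of_ne h; omega⟩

/-- When the `j`-th entry of a list of length `n` is replaced by a list of length `m`, this is the
new position of the `l`-th entry of the inserted list. -/
def innerIdx {n m : ℕ} (j : Fin n) (l : Fin m) : Fin (n + m - 1) :=
  ⟨j + l, by omega⟩

/-- The positions of the substituted list are the old positions different from `j` together with
the positions of the inserted list. -/
def split {n m : ℕ} (j : Fin n) : Fin (n + m - 1) ≃ {i : Fin n // i ≠ j} ⊕ Fin m where
  toFun p :=
    if h₁ : p.1 < j.1 then Sum.inl ⟨⟨p, by omega⟩, fun h => by simp [← h] at h₁⟩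
    else if h₂ : p.1 < j.1 + m then Sum.inr ⟨p - j, by omega⟩
    else Sum.inl ⟨⟨p + 1 - m, by omega⟩, fun h => by
      have := congrArg Fin.val h
      simp only at this
      omega⟩
  invFun := Sum.elim (fun i => outerIdx m j i.1 i.2) (fun l => innerIdx j l)
  left_inv p := by
    dsimp only
    split_ifs with h₁ h₂
    · ext
      simp only [outerIdx, Sum.elim_inl]
      rw [dif_pos h₁]
    · ext
      simp only [innerIdx, Sum.elim_inr]
      omega
    · ext
      simp only [outerIdx, Sum.elim_inl]
      split_ifs with h₃ <;> simp only at * <;> omega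
  right_inv s := by
    rcases s with ⟨i, hi⟩ | l
    · have hv := Fin.val_ne_of_ne hi
      simp only [outerIdx, Sum.elim_inl]
      by_cases h : i.1 < j.1
      · simp [h]
      · simp only [h, dif_neg, not_false_eq_true]
        have h₁ : ¬ (i.1 + m - 1 < j.1) := by omega
        have h₂ : ¬ (i.1 + m - 1 < j.1 + m) := by omega
        simp only [h₁, h₂, dif_neg, not_false_eq_true, Sum.inl.injEq, Subtype.mk.injEq]
        ext
        simp only
        omega
    · simp [innerIdx]

/-- `c.subst i d` is the list `(c₁ … c_{i-1} d₁ … dₘ c_{i+1} … cₙ)`. -/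
abbrev subst {C : Type u} (c : SMon C) (i : Fin c.len) (d : SMon C) : SMon C where
  len := c.len + d.len - 1
  col p := Sum.elim (fun j => c.col j.1) d.col (split i p)

/-- The position in `c.subst i d` of the `j`-th entry of `c`, `j ≠ i`. -/
def outPos {C : Type u} (c : SMon C) (i : Fin c.len) (d : SMon C) (j : Fin c.len) (h : j ≠ i) :
    Fin (c.subst i d).len :=
  outerIdx d.len i j h

theorem outPos_val {C : Type u} (c : SMon C) (i : Fin c.len) (d : SMon C) (j : Fin c.len)
    (h : j ≠ i) : (outPos c i d j h).1 = if j.1 < i.1 then j.1 else j.1 + d.len - 1 := by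
  unfold outPos outerIdx
  split_ifs <;> rfl

/-- The position in `c.subst i d` of the `l`-th entry of `d`. -/
def inPos {C : Type u} (c : SMon C) (i : Fin c.len) (d : SMon C) (l : Fin d.len) :
    Fin (c.subst i d).len :=
  innerIdx i l

theorem inPos_val {C : Type u} (c : SMon C) (i : Fin c.len) (d : SMon C) (l : Fin d.len) :
    (inPos c i d l).1 = i.1 + l.1 := rfl

theorem subst_outPos {C : Type u} (c : SMon C) (i : Fin c.len) (d : SMon C) (j : Fin c.len)
    (h : j ≠ i) : (c.subst i d).col (outPos c i d j h) = c.col j := by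
  change Sum.elim _ _ (split i ((split i).symm (Sum.inl ⟨j, h⟩))) = _
  rw [Equiv.apply_symm_apply]
  rfl

theorem subst_inPos {C : Type u} (c : SMon C) (i : Fin c.len) (d : SMon C) (l : Fin d.len) :
    (c.subst i d).col (inPos c i d l) = d.col l := by
  change Sum.elim _ _ (split i ((split i).symm (Sum.inr l))) = _
  rw [Equiv.apply_symm_apply]
  rfl

theorem inPos_injective {C : Type u} {c : SMon C} (i : Fin c.len) {d : SMon C} (l l' : Fin d.len)
    (h : inPos c i d l = inPos c i d l') : l = l' := by
  have := (split i).symm.injective (a₁ := Sum.inr l) (a₂ := Sum.inr l') h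
  exact Sum.inr_injective this

theorem outPos_injective {C : Type u} {c : SMon C} (i : Fin c.len) {d : SMon C} (j j' : Fin c.len) (h : j ≠ i)
    (h' : j' ≠ i) (e : outPos c i d j h = outPos c i d j' h') : j = j' := by
  have := (split i).symm.injective (a₁ := Sum.inl ⟨j, h⟩) (a₂ := Sum.inl ⟨j', h'⟩) e
  exact congrArg Subtype.val (Sum.inl_injective this)

theorem outPos_ne_inPos {C : Type u} {c : SMon C} (i : Fin c.len) {d : SMon C} (j : Fin c.len) (h : j ≠ i)
    (l : Fin d.len) : outPos c i d j h ≠ inPos c i d l := fun e => by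
  have := (split i).symm.injective (a₁ := Sum.inl ⟨j, h⟩) (a₂ := Sum.inr l) e
  cases this

theorem pos_cases {C : Type u} {c : SMon C} (i : Fin c.len) {d : SMon C} (p : Fin (c.subst i d).len) :
    (∃ l : Fin d.len, p = inPos c i d l) ∨ ∃ (j : Fin c.len) (h : j ≠ i), p = outPos c i d j h := by
  rcases hs : split (m := d.len) i p with ⟨j, h⟩ | l
  · exact Or.inr ⟨j, h, ((split i).eq_symm_apply.2 hs)⟩
  · exact Or.inl ⟨l, ((split i).eq_symm_apply.2 hs)⟩

/-- The `p`-th entry of a list, if there is one. -/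
def entry {C : Type u} (c : SMon C) (p : ℕ) : Option C :=
  if h : p < c.len then some (c.col ⟨p, h⟩) else none

theorem ext_entry {C : Type u} {c d : SMon C} (h : c.len = d.len)
    (h' : ∀ p, c.entry p = d.entry p) : c = d := by
  obtain ⟨n, c⟩ := c
  obtain ⟨m, d⟩ := d
  obtain rfl : n = m := h
  congr
  funext p
  simpa [entry] using h' p

theorem entry_subst {C : Type u} (c : SMon C) (i : Fin c.len) (d : SMon C) (p : ℕ) :
    (c.subst i d).entry p = if p < i.1 then c.entry p
      else if p < i.1 + d.len then d.entry (p - i) else c.entry (p + 1 - d.len) := by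
  have hi := i.2
  by_cases hp : p < c.len + d.len - 1
  · simp only [subst, entry, dif_pos hp, split, Equiv.coe_fn_mk]
    split_ifs <;> first | rfl | omega
  · simp only [subst, entry, dif_neg hp]
    split_ifs <;> first | rfl | omega

/-- Sequential associativity of substitution. -/
theorem subst_seq {C : Type u} (c : SMon C) (i : Fin c.len) (d : SMon C) (l : Fin d.len)
    (e : SMon C) : (c.subst i d).subst (inPos c i d l) e = c.subst i (d.subst l e) := by
  have hi := i.2
  have hl := l.2
  refine ext_entry ?_ fun p => ?_
  · change c.len + d.len - 1 + e.len - 1 = c.len + (d.len + e.len - 1) - 1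
    omega
  · have hv : (inPos c i d l).1 = i.1 + l.1 := rfl
    have hd : (d.subst l e).len = d.len + e.len - 1 := rfl
    rw [entry_subst (c.subst i d), hv, entry_subst c i (d.subst l e), hd]
    simp only [entry_subst]
    split_ifs <;> first | rfl | omega | (congr 1; omega)

/-- Parallel associativity of substitution. -/
theorem subst_par {C : Type u} (c : SMon C) (i j : Fin c.len) (h : i ≠ j) (d e : SMon C) :
    (c.subst j d).subst (outPos c j d i h) e =
      (c.subst i e).subst (outPos c i e j h.symm) d := by
  have hi := i.2
  have hj := j.2
  refine ext_entry ?_ fun p => ?_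
  · change c.len + d.len - 1 + e.len - 1 = c.len + e.len - 1 + d.len - 1
    omega
  · rw [entry_subst (c.subst j d), entry_subst (c.subst i e)]
    simp only [entry_subst]
    rcases lt_or_gt_of_ne (Fin.val_ne_of_ne h) with hlt | hlt
    · have o₁ : (outPos c j d i h).1 = i.1 := by rw [outPos_val, if_pos hlt]
      have o₂ : (outPos c i e j h.symm).1 = j.1 + e.len - 1 := by
        rw [outPos_val, if_neg hlt.le.not_gt]
      rw [o₁, o₂]
      split_ifs <;> first | rfl | omega | (congr 1; omega)
    · have o₁ : (outPos c j d i h).1 = i.1 + d.len - 1 := by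
        rw [outPos_val, if_neg hlt.le.not_gt]
      have o₂ : (outPos c i e j h.symm).1 = j.1 := by rw [outPos_val, if_pos hlt]
      rw [o₁, o₂]
      split_ifs <;> first | rfl | omega | (congr 1; omega)

section Insert

variable {C : Type u} [SmallCategory C]

/-- `σ ∘ᵢ τ`: the bijection of substituted lists which moves the inserted block according to `τ`
and everything else according to `σ`. -/
def insertPerm {n n' m m' : ℕ} (σ : Fin n ≃ Fin n') (i : Fin n) (τ : Fin m ≃ Fin m') :
    Fin (n + m - 1) ≃ Fin (n' + m' - 1) :=
  (split i).trans ((Equiv.sumCongr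
    (σ.subtypeEquiv fun _ => not_congr σ.injective.eq_iff.symm) τ).trans (split (σ i)).symm)

/-- The components of `insert`, on the level of the disjoint union of positions. -/
def insertApp {c c' d d' : SMon C} (φ : c ⟶ c') (i : Fin c.len) (ψ : d ⟶ d') :
    ∀ s : {j : Fin c.len // j ≠ i} ⊕ Fin d.len,
      (Sum.elim (fun j => c.col j.1) d.col s : C) ⟶
        Sum.elim (fun j : {j : Fin c'.len // j ≠ perm φ i} => c'.col j.1) d'.col
          (Equiv.sumCongr ((perm φ).subtypeEquiv
            fun _ => not_congr (perm φ).injective.eq_iff.symm) (perm ψ) s)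
  | Sum.inl j => app φ j.1
  | Sum.inr l => app ψ l

/-- For `φ = (σ, f₁ … fₙ)` and `ψ = (τ, g₁ … gₘ)` this is the morphism
`(σ ∘ᵢ τ, f₁ … g₁ … gₘ … fₙ)` of `𝕊 C`, in which `fᵢ` does not occur. -/
def insert {c c' d d' : SMon C} (φ : c ⟶ c') (i : Fin c.len) (ψ : d ⟶ d') :
    c.subst i d ⟶ c'.subst (perm φ i) d' :=
  Hom.mk (insertPerm (perm φ) i (perm ψ)) fun p =>
    insertApp φ i ψ (split i p) ≫ eqToHom
      (congrArg (Sum.elim (fun j : {j : Fin c'.len // j ≠ perm φ i} => c'.col j.1) d'.col)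
        ((split (perm φ i)).apply_symm_apply _).symm)

end Insert

end SMon

/-! ### Collections and operads coloured by a category -/

/-- `(𝕊 C)ᵒᵖ × C`, that is `∐ₙ ((Cᵒᵖ)ⁿ ⋊ Σₙ) × C`. Its objects are bouquets `(c₁ … cₙ; c)`. -/
abbrev Bq (C : Type u) [SmallCategory C] : Type u := (SMon C)ᵒᵖ × C

/-- (Symmetric) `C`-collections of vector spaces. -/
abbrev Coll (k : Type u) [Field k] (C : Type u) [SmallCategory C] : Type (u + 1) :=
  Bq C ⥤ ModuleCat.{u} k

namespace Coll

variable {k : Type u} [Field k] {C : Type u} [SmallCategory C] (P : Coll k C)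

/-- The space `P(c₁ … cₙ; x)`. -/
abbrev val (c : SMon C) (x : C) : ModuleCat.{u} k := P.obj (op c, x)

/-- The map `P(c'; x) → P(c; x')` induced by `φ : c ⟶ c'` in `𝕊 C` and `u : x ⟶ x'` in `C`. -/
def act {c c' : SMon C} {x x' : C} (φ : c ⟶ c') (u : x ⟶ x') : P.val c' x →ₗ[k] P.val c x' :=
  (P.map (X := (op c', x)) (Y := (op c, x')) (φ.op, u)).hom

/-- The identification of the values of a collection at equal lists and equal colours. -/
def cast {c c' : SMon C} {x x' : C} (hc : c = c') (hx : x = x') : P.val c x →ₗ[k] P.val c' x' :=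
  P.act (eqToHom hc.symm) (eqToHom hx)

theorem act_id {c : SMon C} {x : C} (a : P.val c x) : P.act (𝟙 c) (𝟙 x) a = a := by
  have h := P.map_id (op c, x)
  exact congrArg (fun f => f.hom a) h

theorem act_act {c c' c'' : SMon C} {x x' x'' : C} (φ : c ⟶ c') (φ' : c' ⟶ c'') (u : x ⟶ x')
    (u' : x' ⟶ x'') (a : P.val c'' x) :
    P.act φ u' (P.act φ' u a) = P.act (φ ≫ φ') (u ≫ u') a := by
  have h := P.map_comp (X := (op c'', x)) (Y := (op c', x')) (Z := (op c, x''))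
    (φ'.op, u) (φ.op, u')
  exact (congrArg (fun f => f.hom a) h).symm

end Coll

open SMon in
/-- A (non-unital) `C`-operad `P` in vector spaces over `k`. A natural transformation out of the
coend `P ⊗ᵢ P` is a family of bilinear maps `∘ᵢ : P(c; x) × P(d; cᵢ) → P(c ∘ᵢ d; x)` which is
natural in the inputs and the output and forms a cowedge in the connecting colour `cᵢ`. -/
structure COperad (k : Type u) [Field k] (C : Type u) [SmallCategory C] : Type (u + 1) where
  coll : Coll k C
  comp {c : SMon C} {x : C} (i : Fin c.len) {d : SMon C} :
    coll.val c x →ₗ[k] coll.val d (c.col i) →ₗ[k] coll.val (c.subst i d) x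
  /-- Naturality in all outer variables (`fᵢ = 1`) together with the cowedge condition
  (`fⱼ = 1` for `j ≠ i`). -/
  comp_natural {n m : ℕ} {c c' : Fin n → C} {d d' : Fin m → C} {x x' : C}
    (f : ∀ j, c j ⟶ c' j) (u : x ⟶ x') (i : Fin n) (g : ∀ l, d l ⟶ d' l)
    (α : coll.val ⟨n, c'⟩ x) (β : coll.val ⟨m, d'⟩ (c i)) :
    comp (c := ⟨n, c⟩) (d := ⟨m, d⟩) i (coll.act (ofPi f) u α) (coll.act (ofPi g) (𝟙 (c i)) β) =
      coll.act (insert (ofPi f) i (ofPi g)) u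
        (comp (c := ⟨n, c'⟩) i α (coll.act (𝟙 (⟨m, d'⟩ : SMon C)) (f i) β))
  /-- Equivariance: `∘ᵢ · ((-)σ ⊗ (-)τ) = (-)(σ ∘ᵢ τ) · ∘_{σ i}`. -/
  comp_equivariant {n m : ℕ} {c : Fin n → C} {d : Fin m → C} {x : C}
    (σ : Equiv.Perm (Fin n)) (i : Fin n) (τ : Equiv.Perm (Fin m))
    (α : coll.val ⟨n, c⟩ x) (β : coll.val ⟨m, d⟩ (c (σ i))) :
    comp (c := ⟨n, fun j => c (σ j)⟩) (d := ⟨m, fun l => d (τ l)⟩) i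
        (coll.act (ofPerm σ c) (𝟙 x) α) (coll.act (ofPerm τ d) (𝟙 (c (σ i))) β) =
      coll.act (insert (ofPerm σ c) i (ofPerm τ d)) (𝟙 x) (comp (c := ⟨n, c⟩) (σ i) α β)
  /-- Sequential associativity. -/
  comp_seq {c d e : SMon C} {x : C} (i : Fin c.len) (l : Fin d.len) (α : coll.val c x)
    (β : coll.val d (c.col i)) (γ : coll.val e (d.col l)) :
    comp (inPos c i d l) (comp i α β) (coll.cast rfl (subst_inPos c i d l).symm γ) =
      coll.cast (subst_seq c i d l e).symm rfl (comp i α (comp l β γ))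
  /-- Parallel associativity, for `i < j` as well as for `j < i`. -/
  comp_par {c d e : SMon C} {x : C} (i j : Fin c.len) (h : i ≠ j) (α : coll.val c x)
    (β : coll.val d (c.col j)) (γ : coll.val e (c.col i)) :
    comp (outPos c j d i h) (comp j α β) (coll.cast rfl (subst_outPos c j d i h).symm γ) =
      coll.cast (subst_par c i j h d e).symm rfl
        (comp (outPos c i e j h.symm) (comp i α γ)
          (coll.cast rfl (subst_outPos c i e j h.symm).symm β))

namespace COperad

variable {k : Type u} [Field k] {C : Type u} [SmallCategory C]

/-- The space `P(c₁ … cₙ; x)` of operations of an operad. -/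
abbrev val (P : COperad k C) (c : SMon C) (x : C) : ModuleCat.{u} k := P.coll.val c x

/-- Morphisms of `C`-operads. -/
@[ext]
structure Hom (P Q : COperad k C) : Type u where
  toNat : P.coll ⟶ Q.coll
  map_comp {c d : SMon C} {x : C} (i : Fin c.len) (α : P.val c x) (β : P.val d (c.col i)) :
    (toNat.app (op (c.subst i d), x)).hom (P.comp i α β) =
      Q.comp i ((toNat.app (op c, x)).hom α) ((toNat.app (op d, c.col i)).hom β)

instance : LargeCategory (COperad k C) where
  Hom := Hom
  id P := ⟨𝟙 P.coll, fun _ _ _ => rfl⟩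
  comp f g := ⟨f.toNat ≫ g.toNat, fun i α β => by
    have h₁ := congrArg (fun a => (g.toNat.app _).hom a) (f.map_comp i α β)
    exact h₁.trans (g.map_comp i _ _)⟩
  id_comp _ := Hom.ext (Category.id_comp _)
  comp_id _ := Hom.ext (Category.comp_id _)
  assoc _ _ _ := Hom.ext (Category.assoc _ _ _)

variable (k C) in
/-- The underlying `C`-collection of a `C`-operad. -/
def forget : COperad k C ⥤ Coll k C where
  obj P := P.coll
  map f := Hom.toNat f

/-! ### Operadic ideals and quotients -/

/-- An operadic ideal: a subfunctor closed under composition with arbitrary operations. -/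
@[ext]
structure Ideal (P : COperad k C) : Type u where
  carrier : ∀ (c : SMon C) (x : C), Submodule k (P.val c x)
  act_mem {c c' : SMon C} {x x' : C} (φ : c ⟶ c') (u : x ⟶ x') {a : P.val c' x} :
    a ∈ carrier c' x → P.coll.act φ u a ∈ carrier c x'
  comp_mem_left {c d : SMon C} {x : C} (i : Fin c.len) {a : P.val c x} (b : P.val d (c.col i)) :
    a ∈ carrier c x → P.comp i a b ∈ carrier (c.subst i d) x
  comp_mem_right {c d : SMon C} {x : C} (i : Fin c.len) (a : P.val c x) {b : P.val d (c.col i)} :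
    b ∈ carrier d (c.col i) → P.comp i a b ∈ carrier (c.subst i d) x

/-- The smallest operadic ideal containing a given family of operations. -/
def Ideal.span (P : COperad k C) (A : ∀ (c : SMon C) (x : C), Set (P.val c x)) : P.Ideal where
  carrier c x := sInf {N | ∃ I : P.Ideal, (∀ c x, A c x ⊆ I.carrier c x) ∧ I.carrier c x = N}
  act_mem φ u a ha := by
    rw [Submodule.mem_sInf] at ha ⊢
    rintro _ ⟨I, hI, rfl⟩
    exact I.act_mem φ u (ha _ ⟨I, hI, rfl⟩)
  comp_mem_left i a b ha := by
    rw [Submodule.mem_sInf] at ha ⊢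
    rintro _ ⟨I, hI, rfl⟩
    exact I.comp_mem_left i b (ha _ ⟨I, hI, rfl⟩)
  comp_mem_right i a b hb := by
    rw [Submodule.mem_sInf] at hb ⊢
    rintro _ ⟨I, hI, rfl⟩
    exact I.comp_mem_right i a (hb _ ⟨I, hI, rfl⟩)

section Quotient

variable (P : COperad k C) (I : P.Ideal)

/-- The collection `P / I`. -/
def quotColl : Coll k C where
  obj Z := ModuleCat.of k (P.coll.obj Z ⧸ I.carrier Z.1.unop Z.2)
  map {Z W} f := ModuleCat.ofHom (Submodule.mapQ _ _ (P.coll.map f).hom fun _ ha =>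
    I.act_mem f.1.unop f.2 ha)
  map_id Z := by
    ext a
    have h := congrArg (fun f => f.hom a) (P.coll.map_id Z)
    exact congrArg (Submodule.Quotient.mk) h
  map_comp {Z W V} f g := by
    ext a
    have h := congrArg (fun f => f.hom a) (P.coll.map_comp f g)
    exact congrArg (Submodule.Quotient.mk) h

/-- The composition of `P / I`. -/
def quotComp {c : SMon C} {x : C} (i : Fin c.len) {d : SMon C} :
    (quotColl P I).val c x →ₗ[k] (quotColl P I).val d (c.col i) →ₗ[k]
      (quotColl P I).val (c.subst i d) x :=
  Submodule.liftQ (I.carrier c x)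
    { toFun := fun a => Submodule.mapQ (I.carrier d (c.col i)) (I.carrier (c.subst i d) x)
        (P.comp i a) fun _ hb => I.comp_mem_right i a hb
      map_add' := fun a a' => Submodule.linearMap_qext _ (LinearMap.ext fun b =>
        congrArg Submodule.Quotient.mk (LinearMap.congr_fun (map_add (P.comp i) a a') b))
      map_smul' := fun r a => Submodule.linearMap_qext _ (LinearMap.ext fun b =>
        congrArg Submodule.Quotient.mk (LinearMap.congr_fun (map_smul (P.comp i) r a) b)) }
    (fun _ ha => Submodule.linearMap_qext _ (LinearMap.ext fun b =>
      (Submodule.Quotient.mk_eq_zero _).2 (I.comp_mem_left i b ha)))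

/-- The quotient `P / I` of an operad by an operadic ideal. -/
def quot : COperad k C where
  coll := quotColl P I
  comp := quotComp P I
  comp_natural f u i g α β := by
    obtain ⟨α, rfl⟩ := Submodule.Quotient.mk_surjective _ α
    obtain ⟨β, rfl⟩ := Submodule.Quotient.mk_surjective _ β
    exact congrArg Submodule.Quotient.mk (P.comp_natural f u i g α β)
  comp_equivariant σ i τ α β := by
    obtain ⟨α, rfl⟩ := Submodule.Quotient.mk_surjective _ α
    obtain ⟨β, rfl⟩ := Submodule.Quotient.mk_surjective _ β
    exact congrArg Submodule.Quotient.mk (P.comp_equivariant σ i τ α β)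
  comp_seq i l α β γ := by
    obtain ⟨α, rfl⟩ := Submodule.Quotient.mk_surjective _ α
    obtain ⟨β, rfl⟩ := Submodule.Quotient.mk_surjective _ β
    obtain ⟨γ, rfl⟩ := Submodule.Quotient.mk_surjective _ γ
    exact congrArg Submodule.Quotient.mk (P.comp_seq i l α β γ)
  comp_par i j h α β γ := by
    obtain ⟨α, rfl⟩ := Submodule.Quotient.mk_surjective _ α
    obtain ⟨β, rfl⟩ := Submodule.Quotient.mk_surjective _ β
    obtain ⟨γ, rfl⟩ := Submodule.Quotient.mk_surjective _ γ
    exact congrArg Submodule.Quotient.mk (P.comp_par i j h α β γ)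

end Quotient

end COperad

/-! ### Free operads -/

/-- Non-symmetric `C`-collections: a functor `(Cᵒᵖ)ⁿ × C ⥤ Vect` for every `n`. -/
abbrev NSColl (k : Type u) [Field k] (C : Type u) [SmallCategory C] : Type (u + 1) :=
  ∀ n : ℕ, (Fin n → C)ᵒᵖ × C ⥤ ModuleCat.{u} k

section Free

variable {k : Type u} [Field k] {C : Type u} [SmallCategory C]

/-- Formal operadic expressions in the elements of a non-symmetric collection. -/
inductive FreeTerm (X : NSColl k C) : SMon C → C → Type u
  | gen {n : ℕ} {c : Fin n → C} {x : C} (a : (X n).obj (op c, x)) : FreeTerm X ⟨n, c⟩ x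
  | act {c c' : SMon C} {x x' : C} (φ : c ⟶ c') (u : x ⟶ x') (s : FreeTerm X c' x) :
      FreeTerm X c x'
  | comp {c d : SMon C} {x : C} (i : Fin c.len) (s : FreeTerm X c x)
      (t : FreeTerm X d (c.col i)) : FreeTerm X (c.subst i d) x
  | zero {c : SMon C} {x : C} : FreeTerm X c x
  | add {c : SMon C} {x : C} (s t : FreeTerm X c x) : FreeTerm X c x
  | smul {c : SMon C} {x : C} (r : k) (s : FreeTerm X c x) : FreeTerm X c x

namespace FreeTerm

variable {X : NSColl k C}

/-- The identification of expressions with equal lists of inputs and equal outputs. -/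
def cast {c c' : SMon C} {x x' : C} (hc : c = c') (hx : x = x') (s : FreeTerm X c x) :
    FreeTerm X c' x' :=
  act (eqToHom hc.symm) (eqToHom hx) s

open SMon in
/-- The smallest congruence on formal expressions which makes them a `C`-operad in vector spaces
receiving a morphism of non-symmetric collections from `X`. -/
inductive Rel : ∀ {c : SMon C} {x : C}, FreeTerm X c x → FreeTerm X c x → Prop
  -- equivalence relation
  | refl {c : SMon C} {x : C} (s : FreeTerm X c x) : Rel s s
  | symm {c : SMon C} {x : C} {s t : FreeTerm X c x} : Rel s t → Rel t s
  | trans {c : SMon C} {x : C} {s t r : FreeTerm X c x} : Rel s t → Rel t r → Rel s r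
  -- congruence
  | act_congr {c c' : SMon C} {x x' : C} (φ : c ⟶ c') (u : x ⟶ x') {s t : FreeTerm X c' x} :
      Rel s t → Rel (act φ u s) (act φ u t)
  | comp_congr {c d : SMon C} {x : C} (i : Fin c.len) {s s' : FreeTerm X c x}
      {t t' : FreeTerm X d (c.col i)} : Rel s s' → Rel t t' → Rel (comp i s t) (comp i s' t')
  | add_congr {c : SMon C} {x : C} {s s' t t' : FreeTerm X c x} :
      Rel s s' → Rel t t' → Rel (add s t) (add s' t')
  | smul_congr {c : SMon C} {x : C} (r : k) {s t : FreeTerm X c x} :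
      Rel s t → Rel (smul r s) (smul r t)
  -- vector space axioms
  | add_assoc {c : SMon C} {x : C} (s t r : FreeTerm X c x) :
      Rel (add (add s t) r) (add s (add t r))
  | add_comm {c : SMon C} {x : C} (s t : FreeTerm X c x) : Rel (add s t) (add t s)
  | zero_add {c : SMon C} {x : C} (s : FreeTerm X c x) : Rel (add zero s) s
  | zero_smul {c : SMon C} {x : C} (s : FreeTerm X c x) : Rel (smul 0 s) zero
  | one_smul {c : SMon C} {x : C} (s : FreeTerm X c x) : Rel (smul 1 s) s
  | mul_smul {c : SMon C} {x : C} (a b : k) (s : FreeTerm X c x) :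
      Rel (smul (a * b) s) (smul a (smul b s))
  | smul_add {c : SMon C} {x : C} (a : k) (s t : FreeTerm X c x) :
      Rel (smul a (add s t)) (add (smul a s) (smul a t))
  | add_smul {c : SMon C} {x : C} (a b : k) (s : FreeTerm X c x) :
      Rel (smul (a + b) s) (add (smul a s) (smul b s))
  -- `X` is included linearly and naturally
  | gen_add {n : ℕ} {c : Fin n → C} {x : C} (a b : (X n).obj (op c, x)) :
      Rel (gen (a + b)) (add (gen a) (gen b))
  | gen_smul {n : ℕ} {c : Fin n → C} {x : C} (r : k) (a : (X n).obj (op c, x)) :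
      Rel (gen (r • a)) (smul r (gen a))
  | gen_natural {n : ℕ} {c c' : Fin n → C} {x x' : C} (f : c ⟶ c') (u : x ⟶ x')
      (a : (X n).obj (op c', x)) :
      Rel (gen (((X n).map (X := (op c', x)) (Y := (op c, x')) (f.op, u)).hom a))
        (act (ofPi f) u (gen a))
  -- the actions form a functor to vector spaces
  | act_add {c c' : SMon C} {x x' : C} (φ : c ⟶ c') (u : x ⟶ x') (s t : FreeTerm X c' x) :
      Rel (act φ u (add s t)) (add (act φ u s) (act φ u t))
  | act_smul {c c' : SMon C} {x x' : C} (φ : c ⟶ c') (u : x ⟶ x') (r : k)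
      (s : FreeTerm X c' x) : Rel (act φ u (smul r s)) (smul r (act φ u s))
  | act_id {c : SMon C} {x : C} (s : FreeTerm X c x) : Rel (act (𝟙 c) (𝟙 x) s) s
  | act_act {c c' c'' : SMon C} {x x' x'' : C} (φ : c ⟶ c') (φ' : c' ⟶ c'') (u : x ⟶ x')
      (u' : x' ⟶ x'') (s : FreeTerm X c'' x) :
      Rel (act φ u' (act φ' u s)) (act (φ ≫ φ') (u ≫ u') s)
  -- the compositions are bilinear
  | comp_add_left {c d : SMon C} {x : C} (i : Fin c.len) (s s' : FreeTerm X c x)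
      (t : FreeTerm X d (c.col i)) : Rel (comp i (add s s') t) (add (comp i s t) (comp i s' t))
  | comp_smul_left {c d : SMon C} {x : C} (i : Fin c.len) (r : k) (s : FreeTerm X c x)
      (t : FreeTerm X d (c.col i)) : Rel (comp i (smul r s) t) (smul r (comp i s t))
  | comp_add_right {c d : SMon C} {x : C} (i : Fin c.len) (s : FreeTerm X c x)
      (t t' : FreeTerm X d (c.col i)) : Rel (comp i s (add t t')) (add (comp i s t) (comp i s t'))
  | comp_smul_right {c d : SMon C} {x : C} (i : Fin c.len) (r : k) (s : FreeTerm X c x)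
      (t : FreeTerm X d (c.col i)) : Rel (comp i s (smul r t)) (smul r (comp i s t))
  -- the axioms of a `C`-operad
  | comp_natural {n m : ℕ} {c c' : Fin n → C} {d d' : Fin m → C} {x x' : C}
      (f : ∀ j, c j ⟶ c' j) (u : x ⟶ x') (i : Fin n) (g : ∀ l, d l ⟶ d' l)
      (s : FreeTerm X ⟨n, c'⟩ x) (t : FreeTerm X ⟨m, d'⟩ (c i)) :
      Rel (comp (c := ⟨n, c⟩) (d := ⟨m, d⟩) i (act (ofPi f) u s) (act (ofPi g) (𝟙 (c i)) t))
        (act (insert (ofPi f) i (ofPi g)) u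
          (comp (c := ⟨n, c'⟩) i s (act (𝟙 (⟨m, d'⟩ : SMon C)) (f i) t)))
  | comp_equivariant {n m : ℕ} {c : Fin n → C} {d : Fin m → C} {x : C}
      (σ : Equiv.Perm (Fin n)) (i : Fin n) (τ : Equiv.Perm (Fin m))
      (s : FreeTerm X ⟨n, c⟩ x) (t : FreeTerm X ⟨m, d⟩ (c (σ i))) :
      Rel (comp (c := ⟨n, fun j => c (σ j)⟩) (d := ⟨m, fun l => d (τ l)⟩) i
          (act (ofPerm σ c) (𝟙 x) s) (act (ofPerm τ d) (𝟙 (c (σ i))) t))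
        (act (insert (ofPerm σ c) i (ofPerm τ d)) (𝟙 x) (comp (c := ⟨n, c⟩) (σ i) s t))
  | comp_seq {c d e : SMon C} {x : C} (i : Fin c.len) (l : Fin d.len) (s : FreeTerm X c x)
      (t : FreeTerm X d (c.col i)) (r : FreeTerm X e (d.col l)) :
      Rel (comp (inPos c i d l) (comp i s t) (cast rfl (subst_inPos c i d l).symm r))
        (cast (subst_seq c i d l e).symm rfl (comp i s (comp l t r)))
  | comp_par {c d e : SMon C} {x : C} (i j : Fin c.len) (h : i ≠ j) (s : FreeTerm X c x)
      (t : FreeTerm X d (c.col j)) (r : FreeTerm X e (c.col i)) :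
      Rel (comp (outPos c j d i h) (comp j s t) (cast rfl (subst_outPos c j d i h).symm r))
        (cast (subst_par c i j h d e).symm rfl
          (comp (outPos c i e j h.symm) (comp i s r)
            (cast rfl (subst_outPos c i e j h.symm).symm t)))

instance setoid (X : NSColl k C) (c : SMon C) (x : C) : Setoid (FreeTerm X c x) :=
  ⟨Rel, ⟨Rel.refl, Rel.symm, Rel.trans⟩⟩

end FreeTerm

/-- The spaces of operations of the free operad on `X`. -/
def FreeOp (X : NSColl k C) (c : SMon C) (x : C) : Type u := Quotient (FreeTerm.setoid X c x)

namespace FreeOp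

variable {X : NSColl k C}

open FreeTerm

instance (c : SMon C) (x : C) : Zero (FreeOp X c x) := ⟨Quotient.mk _ FreeTerm.zero⟩

instance (c : SMon C) (x : C) : Add (FreeOp X c x) :=
  ⟨Quotient.map₂ FreeTerm.add fun _ _ h _ _ h' => Rel.add_congr h h'⟩

instance (c : SMon C) (x : C) : AddCommMonoid (FreeOp X c x) where
  add_assoc := by
    rintro ⟨s⟩ ⟨t⟩ ⟨r⟩
    exact Quotient.sound (Rel.add_assoc s t r)
  add_comm := by
    rintro ⟨s⟩ ⟨t⟩
    exact Quotient.sound (Rel.add_comm s t)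
  zero_add := by
    rintro ⟨s⟩
    exact Quotient.sound (Rel.zero_add s)
  add_zero := by
    rintro ⟨s⟩
    exact Quotient.sound (Rel.trans (Rel.add_comm s _) (Rel.zero_add s))
  nsmul := nsmulRec

theorem smul_zero_aux {c : SMon C} {x : C} (r : k) :
    Rel (FreeTerm.smul r (FreeTerm.zero : FreeTerm X c x)) FreeTerm.zero :=
  ((Rel.smul_congr r (Rel.zero_smul FreeTerm.zero).symm).trans
    (Rel.mul_smul r 0 FreeTerm.zero).symm).trans (by
      rw [mul_zero]
      exact Rel.zero_smul _)

instance (c : SMon C) (x : C) : Module k (FreeOp X c x) where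
  smul r := Quotient.map (FreeTerm.smul r) fun _ _ h => Rel.smul_congr r h
  one_smul := by
    rintro ⟨s⟩
    exact Quotient.sound (Rel.one_smul s)
  mul_smul := by
    rintro a b ⟨s⟩
    exact Quotient.sound (Rel.mul_smul a b s)
  smul_zero r := Quotient.sound (smul_zero_aux r)
  smul_add := by
    rintro a ⟨s⟩ ⟨t⟩
    exact Quotient.sound (Rel.smul_add a s t)
  add_smul := by
    rintro a b ⟨s⟩
    exact Quotient.sound (Rel.add_smul a b s)
  zero_smul := by
    rintro ⟨s⟩
    exact Quotient.sound (Rel.zero_smul s)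

instance (c : SMon C) (x : C) : AddCommGroup (FreeOp X c x) := Module.addCommMonoidToAddCommGroup k

/-- The action of morphisms on the free operad. -/
def actHom {c c' : SMon C} {x x' : C} (φ : c ⟶ c') (u : x ⟶ x') :
    FreeOp X c' x →ₗ[k] FreeOp X c x' where
  toFun := Quotient.map (FreeTerm.act φ u) fun _ _ h => Rel.act_congr φ u h
  map_add' := by
    rintro ⟨s⟩ ⟨t⟩
    exact Quotient.sound (Rel.act_add φ u s t)
  map_smul' := by
    rintro r ⟨s⟩
    exact Quotient.sound (Rel.act_smul φ u r s)

/-- The compositions of the free operad. -/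
def compHom {c : SMon C} {x : C} (i : Fin c.len) {d : SMon C} :
    FreeOp X c x →ₗ[k] FreeOp X d (c.col i) →ₗ[k] FreeOp X (c.subst i d) x :=
  LinearMap.mk₂ k (Quotient.map₂ (FreeTerm.comp i) fun _ _ h _ _ h' => Rel.comp_congr i h h')
    (by
      rintro ⟨s⟩ ⟨s'⟩ ⟨t⟩
      exact Quotient.sound (Rel.comp_add_left i s s' t))
    (by
      rintro r ⟨s⟩ ⟨t⟩
      exact Quotient.sound (Rel.comp_smul_left i r s t))
    (by
      rintro ⟨s⟩ ⟨t⟩ ⟨t'⟩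
      exact Quotient.sound (Rel.comp_add_right i s t t'))
    (by
      rintro r ⟨s⟩ ⟨t⟩
      exact Quotient.sound (Rel.comp_smul_right i r s t))

end FreeOp

/-- The underlying collection of the free operad. -/
def freeColl (X : NSColl k C) : Coll k C where
  obj Z := ModuleCat.of k (FreeOp X Z.1.unop Z.2)
  map f := ModuleCat.ofHom (FreeOp.actHom f.1.unop f.2)
  map_id Z := by
    refine ModuleCat.hom_ext (LinearMap.ext ?_)
    rintro ⟨s⟩
    exact Quotient.sound (FreeTerm.Rel.act_id s)
  map_comp {Z W V} f g := by
    refine ModuleCat.hom_ext (LinearMap.ext ?_)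
    rintro ⟨s⟩
    exact Quotient.sound (FreeTerm.Rel.act_act g.1.unop f.1.unop f.2 g.2 s).symm

/-- The free `C`-operad on a non-symmetric `C`-collection. -/
def freeOperad (X : NSColl k C) : COperad k C where
  coll := freeColl X
  comp i := FreeOp.compHom i
  comp_natural f u i g := by
    rintro ⟨s⟩ ⟨t⟩
    exact Quotient.sound (FreeTerm.Rel.comp_natural f u i g s t)
  comp_equivariant σ i τ := by
    rintro ⟨s⟩ ⟨t⟩
    exact Quotient.sound (FreeTerm.Rel.comp_equivariant σ i τ s t)
  comp_seq i l := by
    rintro ⟨s⟩ ⟨t⟩ ⟨r⟩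
    exact Quotient.sound (FreeTerm.Rel.comp_seq i l s t r)
  comp_par i j h := by
    rintro ⟨s⟩ ⟨t⟩ ⟨r⟩
    exact Quotient.sound (FreeTerm.Rel.comp_par i j h s t r)

/-- The inclusion of the generators into the free operad. -/
def freeGen (X : NSColl k C) {n : ℕ} {c : Fin n → C} {x : C} :
    (X n).obj (op c, x) →ₗ[k] (freeOperad X).val ⟨n, c⟩ x where
  toFun a := Quotient.mk (FreeTerm.setoid X ⟨n, c⟩ x) (FreeTerm.gen a)
  map_add' a b := Quotient.sound (FreeTerm.Rel.gen_add a b)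
  map_smul' r a := Quotient.sound (FreeTerm.Rel.gen_smul r a)

/-- Operations of weight `w` in the free operad: linear combinations of composites of `w`
generators. -/
inductive HasWeight (X : NSColl k C) : ℕ → ∀ (c : SMon C) (x : C), (freeOperad X).val c x → Prop
  | gen {n : ℕ} {c : Fin n → C} {x : C} (a : (X n).obj (op c, x)) :
      HasWeight X 1 ⟨n, c⟩ x (freeGen X a)
  | act {w : ℕ} {c c' : SMon C} {x x' : C} (φ : c ⟶ c') (u : x ⟶ x')
      {a : (freeOperad X).val c' x} :
      HasWeight X w c' x a → HasWeight X w c x' ((freeOperad X).coll.act φ u a)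
  | comp {v w : ℕ} {c d : SMon C} {x : C} (i : Fin c.len) {a : (freeOperad X).val c x}
      {b : (freeOperad X).val d (c.col i)} : HasWeight X v c x a → HasWeight X w d (c.col i) b →
      HasWeight X (v + w) (c.subst i d) x ((freeOperad X).comp i a b)
  | zero {w : ℕ} {c : SMon C} {x : C} : HasWeight X w c x 0
  | add {w : ℕ} {c : SMon C} {x : C} {a b : (freeOperad X).val c x} :
      HasWeight X w c x a → HasWeight X w c x b → HasWeight X w c x (a + b)
  | smul {w : ℕ} {c : SMon C} {x : C} (r : k) {a : (freeOperad X).val c x} :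
      HasWeight X w c x a → HasWeight X w c x (r • a)

/-- An operad is binary quadratic if it is of the form `F(X) / (A)`, where `X` is concentrated in
arity `2` and all operations in `A` have weight `2`. -/
def COperad.IsBinaryQuadratic (P : COperad k C) : Prop :=
  ∃ (X : NSColl k C) (A : ∀ (c : SMon C) (x : C), Set ((freeOperad X).val c x)),
    (∀ n, n ≠ 2 → ∀ Z, Subsingleton ((X n).obj Z)) ∧
    (∀ c x, ∀ a ∈ A c x, HasWeight X 2 c x a) ∧
    Nonempty (P ≅ (freeOperad X).quot (COperad.Ideal.span _ A))

end Free

/-! ### Endomorphism operads and algebras -/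

section End

variable {k : Type u} [Field k] {C : Type u} [SmallCategory C] (A : C ⥤ ModuleCat.{u} k)

namespace EndOp

open SMon

/-- Tuples of vectors in `A(c₁), …, A(cₙ)`. -/
abbrev Tup (c : SMon C) : Type u := ∀ p, A.obj (c.col p)

/-- Transport of vectors along an equality of colours. -/
def tr {x y : C} (h : x = y) : A.obj x →ₗ[k] A.obj y := (A.map (eqToHom h)).hom

theorem tr_rfl {x : C} (a : A.obj x) : tr A (rfl : x = x) a = a := by
  simp [tr]

theorem tr_tr {x y z : C} (h : x = y) (h' : y = z) (a : A.obj x) :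
    tr A h' (tr A h a) = tr A (h.trans h') a := by
  subst h h'
  simp [tr]

theorem tr_congr {c : SMon C} (v : Tup A c) {p q : Fin c.len} (h : p = q) {y : C}
    (hp : c.col p = y) (hq : c.col q = y) : tr A hp (v p) = tr A hq (v q) := by
  subst h
  rfl

variable {A}

/-- A morphism `(σ, f₁ … fₙ)` sends a tuple to the tuple with `A(fᵢ)(vᵢ)` at the place `σ i`. -/
def push {c c' : SMon C} (φ : c ⟶ c') (v : Tup A c) : Tup A c' := fun q =>
  tr A (congrArg c'.col ((perm φ).apply_symm_apply q))
    ((A.map (app φ ((perm φ).symm q))).hom (v ((perm φ).symm q)))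

theorem push_of_eq {c c' : SMon C} (φ : c ⟶ c') (v : Tup A c) (p : Fin c.len) (q : Fin c'.len)
    (h : perm φ p = q) : push φ v q = tr A (congrArg c'.col h) ((A.map (app φ p)).hom (v p)) := by
  obtain rfl : p = (perm φ).symm q := by rw [← h, Equiv.symm_apply_apply]
  rfl

theorem push_perm {c c' : SMon C} (φ : c ⟶ c') (v : Tup A c) (p : Fin c.len) :
    push φ v (perm φ p) = (A.map (app φ p)).hom (v p) := by
  rw [push_of_eq φ v p _ rfl, tr_rfl]

theorem tup_ext {c c' : SMon C} (φ : c ⟶ c') {v w : Tup A c'}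
    (h : ∀ p, v (perm φ p) = w (perm φ p)) : v = w := by
  funext q
  obtain ⟨p, rfl⟩ := (perm φ).surjective q
  exact h p

theorem push_id {c : SMon C} (v : Tup A c) : push (𝟙 c) v = v := by
  refine tup_ext (𝟙 c) fun p => ?_
  rw [push_perm]
  change (A.map (𝟙 (c.col p))).hom (v p) = v p
  simp

theorem push_push {c c' c'' : SMon C} (φ : c ⟶ c') (ψ : c' ⟶ c'') (v : Tup A c) :
    push ψ (push φ v) = push (φ ≫ ψ) v := by
  refine tup_ext (φ ≫ ψ) fun p => ?_
  rw [push_perm]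
  change push ψ (push φ v) (perm ψ (perm φ p)) = (A.map (app φ p ≫ app ψ (perm φ p))).hom (v p)
  rw [push_perm, push_perm]
  simp

theorem push_eqToHom {c c' : SMon C} (h : c = c') (v : Tup A c) (p : Fin c.len) (q : Fin c'.len)
    (hpq : p.1 = q.1) (hc : c.col p = c'.col q) : push (eqToHom h) v q = tr A hc (v p) := by
  subst h
  obtain rfl : p = q := Fin.ext hpq
  rw [eqToHom_refl, push_id, tr_rfl]

theorem push_update {c c' : SMon C} (φ : c ⟶ c') [DecidableEq (Fin c.len)] (v : Tup A c)
    (p : Fin c.len) (a : A.obj (c.col p)) : push φ (Function.update v p a) =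
      Function.update (push φ v) (perm φ p) ((A.map (app φ p)).hom a) := by
  refine tup_ext φ fun q => ?_
  rw [push_perm]
  by_cases h : q = p
  · subst h
    simp
  · rw [Function.update_of_ne h, Function.update_of_ne ((perm φ).injective.ne h), push_perm]

/-- The tuple with `a` at the `i`-th place and `w` elsewhere. -/
def fill {c : SMon C} (i : Fin c.len) (a : A.obj (c.col i))
    (w : ∀ j, j ≠ i → A.obj (c.col j)) : Tup A c := fun j =>
  if h : j = i then tr A (congrArg c.col h.symm) a else w j h

theorem fill_same {c : SMon C} (i : Fin c.len) (a : A.obj (c.col i))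
    (w : ∀ j, j ≠ i → A.obj (c.col j)) : fill i a w i = a := by
  rw [fill, dif_pos rfl, tr_rfl]

theorem fill_ne {c : SMon C} (i : Fin c.len) (a : A.obj (c.col i))
    (w : ∀ j, j ≠ i → A.obj (c.col j)) (j : Fin c.len) (h : j ≠ i) : fill i a w j = w j h := by
  rw [fill, dif_neg h]

theorem update_fill {c : SMon C} (i : Fin c.len) (a b : A.obj (c.col i))
    (w : ∀ j, j ≠ i → A.obj (c.col j)) : Function.update (fill i a w) i b = fill i b w := by
  funext j
  by_cases h : j = i
  · subst h
    rw [Function.update_self, fill_same]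
  · rw [Function.update_of_ne h, fill_ne _ _ _ _ h, fill_ne _ _ _ _ h]

/-- The part of a tuple belonging to the inserted list. -/
def inn {c : SMon C} (i : Fin c.len) {d : SMon C} (v : Tup A (c.subst i d)) : Tup A d := fun l =>
  tr A (subst_inPos c i d l) (v (inPos c i d l))

/-- The part of a tuple not belonging to the inserted list. -/
def out {c : SMon C} (i : Fin c.len) {d : SMon C} (v : Tup A (c.subst i d)) :
    ∀ j, j ≠ i → A.obj (c.col j) := fun j h =>
  tr A (subst_outPos c i d j h) (v (outPos c i d j h))

theorem inn_update_inner {c : SMon C} (i : Fin c.len) {d : SMon C}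
    [DecidableEq (Fin (c.subst i d).len)] (v : Tup A (c.subst i d))
    (l : Fin d.len) (a : A.obj ((c.subst i d).col (inPos c i d l))) :
    inn i (Function.update v (inPos c i d l) a) =
      Function.update (inn i v) l (tr A (subst_inPos c i d l) a) := by
  funext l'
  by_cases h : l' = l
  · subst h
    simp [inn]
  · rw [Function.update_of_ne h, inn, inn,
      Function.update_of_ne fun e => h (inPos_injective _ _ _ e)]

theorem out_update_inner {c : SMon C} (i : Fin c.len) {d : SMon C}
    [DecidableEq (Fin (c.subst i d).len)] (v : Tup A (c.subst i d))
    (l : Fin d.len) (a : A.obj ((c.subst i d).col (inPos c i d l))) :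
    out i (Function.update v (inPos c i d l) a) = out i v := by
  funext j h
  rw [out, out, Function.update_of_ne (outPos_ne_inPos i j h l)]

theorem inn_update_outer {c : SMon C} (i : Fin c.len) {d : SMon C}
    [DecidableEq (Fin (c.subst i d).len)] (v : Tup A (c.subst i d))
    (j : Fin c.len) (h : j ≠ i) (a : A.obj ((c.subst i d).col (outPos c i d j h))) :
    inn i (Function.update v (outPos c i d j h) a) = inn i v := by
  funext l
  rw [inn, inn, Function.update_of_ne (outPos_ne_inPos i j h l).symm]

theorem fill_update_outer {c : SMon C} (i : Fin c.len) {d : SMon C}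
    [DecidableEq (Fin (c.subst i d).len)] (v : Tup A (c.subst i d))
    (j : Fin c.len) (h : j ≠ i) (a : A.obj ((c.subst i d).col (outPos c i d j h)))
    (b : A.obj (c.col i)) :
    fill i b (out i (Function.update v (outPos c i d j h) a)) =
      Function.update (fill i b (out i v)) j (tr A (subst_outPos c i d j h) a) := by
  funext j'
  by_cases hi : j' = i
  · subst hi
    rw [Function.update_of_ne h.symm, fill_same, fill_same]
  · rw [fill_ne _ _ _ _ hi]
    by_cases hj : j' = j
    · subst hj
      simp [out]
    · rw [Function.update_of_ne hj, fill_ne _ _ _ _ hi, out, out,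
        Function.update_of_ne fun e => hj (outPos_injective _ _ _ _ _ e)]

variable (A)

/-- `End_A(c₁ … cₙ; x) = Hom(A(c₁) ⊗ ⋯ ⊗ A(cₙ), A(x))`, as a space of multilinear maps. -/
abbrev Op (c : SMon C) (x : C) : Type u :=
  MultilinearMap k (fun p => A.obj (c.col p)) (A.obj x)

variable {A}

/-- The action of `φ = (σ, f₁ … fₙ) : c ⟶ c'` and `u` on `End_A`. -/
def actHom {c c' : SMon C} {x x' : C} (φ : c ⟶ c') (u : x ⟶ x') : Op A c' x →ₗ[k] Op A c x' where
  toFun α :=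
    { toFun := fun v => (A.map u).hom (α (push φ v))
      map_update_add' := fun v p a b => by simp [push_update]
      map_update_smul' := fun v p r a => by simp [push_update] }
  map_add' α β := by
    ext v
    simp
  map_smul' r α := by
    ext v
    simp

theorem actHom_apply {c c' : SMon C} {x x' : C} (φ : c ⟶ c') (u : x ⟶ x') (α : Op A c' x)
    (v : Tup A c) : actHom φ u α v = (A.map u).hom (α (push φ v)) := rfl

/-- `α ∘ᵢ β = α · (1 ⊗ ⋯ ⊗ β ⊗ ⋯ ⊗ 1)`, with `β` at the `i`-th place. -/
def compMap {c d : SMon C} {x : C} (i : Fin c.len) (α : Op A c x) (β : Op A d (c.col i)) :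
    Op A (c.subst i d) x where
  toFun v := α (fill i (β (inn i v)) (out i v))
  map_update_add' v p a b := by
    rcases pos_cases i p with ⟨l, rfl⟩ | ⟨j, h, rfl⟩
    · rw [inn_update_inner i v l, inn_update_inner i v l, inn_update_inner i v l,
        out_update_inner i v l, out_update_inner i v l, out_update_inner i v l, map_add,
        MultilinearMap.map_update_add]
      rw [← update_fill i 0, MultilinearMap.map_update_add, update_fill, update_fill]
    · rw [inn_update_outer i v j h, inn_update_outer i v j h, inn_update_outer i v j h,
        fill_update_outer i v j h, fill_update_outer i v j h, fill_update_outer i v j h, map_add,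
        MultilinearMap.map_update_add]
  map_update_smul' v p r a := by
    rcases pos_cases i p with ⟨l, rfl⟩ | ⟨j, h, rfl⟩
    · rw [inn_update_inner i v l, inn_update_inner i v l, out_update_inner i v l,
        out_update_inner i v l, map_smul, MultilinearMap.map_update_smul]
      rw [← update_fill i 0, MultilinearMap.map_update_smul, update_fill]
    · rw [inn_update_outer i v j h, inn_update_outer i v j h, fill_update_outer i v j h,
        fill_update_outer i v j h, map_smul, MultilinearMap.map_update_smul]

/-- The compositions of `End_A`, as bilinear maps. -/
def compHom {c : SMon C} {x : C} (i : Fin c.len) {d : SMon C} :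
    Op A c x →ₗ[k] Op A d (c.col i) →ₗ[k] Op A (c.subst i d) x :=
  LinearMap.mk₂ k (compMap i)
    (fun _ _ _ => rfl)
    (fun _ _ _ => rfl)
    (fun α β β' => by
      ext v
      change α (fill i (β (inn i v) + β' (inn i v)) (out i v)) =
        α (fill i (β (inn i v)) (out i v)) + α (fill i (β' (inn i v)) (out i v))
      rw [← update_fill i 0, MultilinearMap.map_update_add, update_fill, update_fill])
    (fun r α β => by
      ext v
      change α (fill i (r • β (inn i v)) (out i v)) = r • α (fill i (β (inn i v)) (out i v))
      rw [← update_fill i 0, MultilinearMap.map_update_smul, update_fill])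

theorem compHom_apply {c d : SMon C} {x : C} (i : Fin c.len) (α : Op A c x)
    (β : Op A d (c.col i)) (v : Tup A (c.subst i d)) :
    compHom i α β v = α (fill i (β (inn i v)) (out i v)) := rfl

theorem app_insert {c c' d d' : SMon C} (φ : c ⟶ c') (i : Fin c.len) (ψ : d ⟶ d')
    (s : {j : Fin c.len // j ≠ i} ⊕ Fin d.len) (p : Fin (c.subst i d).len) (h : split i p = s) :
    ∃ (e₁ : _) (e₂ : _), app (insert φ i ψ) p = eqToHom e₁ ≫ insertApp φ i ψ s ≫ eqToHom e₂ := by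
  subst h
  refine ⟨rfl, congrArg (Sum.elim (fun j : {j : Fin c'.len // j ≠ perm φ i} => c'.col j.1) d'.col)
    ((split (perm φ i)).apply_symm_apply _).symm, ?_⟩
  rw [eqToHom_refl, Category.id_comp]
  rfl

theorem perm_insert_inner {c c' d d' : SMon C} (φ : c ⟶ c') (i : Fin c.len) (ψ : d ⟶ d')
    (l : Fin d.len) : perm (insert φ i ψ) (inPos c i d l) = inPos c' (perm φ i) d' (perm ψ l) := by
  change (split (perm φ i)).symm (Equiv.sumCongr _ (perm ψ) (split i ((split i).symm (Sum.inr l))))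
    = (split (perm φ i)).symm (Sum.inr (perm ψ l))
  rw [Equiv.apply_symm_apply]
  rfl

theorem perm_insert_outer {c c' d d' : SMon C} (φ : c ⟶ c') (i : Fin c.len) (ψ : d ⟶ d')
    (j : Fin c.len) (h : j ≠ i) : perm (insert φ i ψ) (outPos c i d j h) =
      outPos c' (perm φ i) d' (perm φ j) ((perm φ).injective.ne h) := by
  change (split (perm φ i)).symm (Equiv.sumCongr _ (perm ψ)
    (split i ((split i).symm (Sum.inl ⟨j, h⟩)))) =
      (split (perm φ i)).symm (Sum.inl ⟨perm φ j, (perm φ).injective.ne h⟩)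
  rw [Equiv.apply_symm_apply]
  rfl

theorem map_eqToHom_sandwich {w x y z : C} (g : w ⟶ z) (f : x ⟶ y) (e₁ : w = x) (e₂ : y = z)
    (hg : g = eqToHom e₁ ≫ f ≫ eqToHom e₂) (a : A.obj w) :
    (A.map g).hom a = tr A e₂ ((A.map f).hom (tr A e₁ a)) := by
  subst hg
  simp [tr]

theorem inn_push {c c' d d' : SMon C} (φ : c ⟶ c') (i : Fin c.len) (ψ : d ⟶ d')
    (v : Tup A (c.subst i d)) :
    inn (perm φ i) (push (insert φ i ψ) v) = push ψ (inn i v) := by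
  refine tup_ext ψ fun l => ?_
  obtain ⟨e₁, e₂, h⟩ := app_insert φ i ψ (Sum.inr l) (inPos c i d l)
    ((split i).apply_symm_apply (Sum.inr l))
  rw [push_perm, inn, push_of_eq _ v _ _ (perm_insert_inner φ i ψ l),
    map_eqToHom_sandwich _ _ e₁ e₂ h]
  rw [tr_tr]
  exact (tr_tr A _ _ _).trans (tr_rfl A _)

theorem out_push {c c' d d' : SMon C} (φ : c ⟶ c') (i : Fin c.len) (ψ : d ⟶ d')
    (v : Tup A (c.subst i d)) (j : Fin c.len) (h : j ≠ i) :
    out (perm φ i) (push (insert φ i ψ) v) (perm φ j) ((perm φ).injective.ne h) =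
      (A.map (app φ j)).hom (out i v j h) := by
  obtain ⟨e₁, e₂, h'⟩ :=
    app_insert φ i ψ (Sum.inl ⟨j, h⟩) (outPos c i d j h)
      ((split i).apply_symm_apply (Sum.inl ⟨j, h⟩))
  rw [out, push_of_eq _ v _ _ (perm_insert_outer φ i ψ j h),
    map_eqToHom_sandwich _ _ e₁ e₂ h']
  rw [tr_tr]
  exact (tr_tr A _ _ _).trans (tr_rfl A _)

theorem comp_act {c c' d d' : SMon C} {x x' y : C} (φ : c ⟶ c') (u : x ⟶ x') (i : Fin c.len)
    (ψ : d ⟶ d') (v : y ⟶ c.col i) (α : Op A c' x) (β : Op A d' y) :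
    compHom i (actHom φ u α) (actHom ψ v β) =
      actHom (insert φ i ψ) u (compHom (perm φ i) α (actHom (𝟙 d') (v ≫ app φ i) β)) := by
  ext w
  rw [compHom_apply, actHom_apply, actHom_apply, actHom_apply, compHom_apply, actHom_apply,
    push_id, inn_push]
  congr 2
  refine tup_ext φ fun j => ?_
  rw [push_perm]
  by_cases h : j = i
  · subst h
    rw [fill_same, fill_same]
    simp
  · rw [fill_ne _ _ _ _ h, fill_ne _ _ _ _ ((perm φ).injective.ne h), out_push φ i ψ w j h]

theorem cast_apply {c c' : SMon C} {x x' : C} (hc : c = c') (hx : x = x') (α : Op A c x)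
    (v : Tup A c') : actHom (eqToHom hc.symm) (eqToHom hx) α v =
      tr A hx (α (push (eqToHom hc.symm) v)) := rfl

theorem comp_seq {c d e : SMon C} {x : C} (i : Fin c.len) (l : Fin d.len) (α : Op A c x)
    (β : Op A d (c.col i)) (γ : Op A e (d.col l)) :
    compHom (inPos c i d l) (compHom i α β)
        (actHom (eqToHom rfl) (eqToHom (subst_inPos c i d l).symm) γ) =
      actHom (eqToHom (subst_seq c i d l e)) (eqToHom rfl) (compHom i α (compHom l β γ)) := by
  ext v
  have e₁ : inn (c := c.subst i d) (inPos c i d l) v =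
      inn l (inn i (push (eqToHom (subst_seq c i d l e)) v)) := by
    funext q
    rw [inn, inn, inn, push_eqToHom (subst_seq c i d l e) v (inPos _ (inPos c i d l) e q)
      (inPos c i (d.subst l e) (inPos d l e q)) (Nat.add_assoc _ _ _)
      (by rw [subst_inPos, subst_inPos, subst_inPos]), tr_tr, tr_tr]
  change α (fill i (β (inn i (fill (inPos c i d l) (tr A _ (γ (push (𝟙 e) (inn _ v)))) (out _ v))))
      (out i (fill (inPos c i d l) (tr A _ (γ (push (𝟙 e) (inn _ v)))) (out _ v)))) =
    tr A rfl (α (fill i (β (fill l (γ (inn l (inn i (push (eqToHom (subst_seq c i d l e)) v))))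
      (out l (inn i (push (eqToHom (subst_seq c i d l e)) v)))))
      (out i (push (eqToHom (subst_seq c i d l e)) v))))
  rw [tr_rfl, push_id, e₁]
  congr 2
  · congr 1
    funext q
    by_cases hq : q = l
    · subst hq
      rw [inn, fill_same, fill_same, tr_tr, tr_rfl]
    · rw [inn, fill_ne _ _ _ _ (fun h => hq (inPos_injective _ _ _ h)), fill_ne _ _ _ _ hq, out,
        out, inn, push_eqToHom (subst_seq c i d l e) v
          (outPos _ (inPos c i d l) e (inPos c i d q) (fun h => hq (inPos_injective _ _ _ h)))
          (inPos c i (d.subst l e) (outPos d l e q hq))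
          (by
            rw [outPos_val, inPos_val, inPos_val, inPos_val, outPos_val]
            rcases lt_or_gt_of_ne (Fin.val_ne_of_ne hq) with h | h
            · rw [if_pos h, if_pos (Nat.add_lt_add_left h _)]
            · rw [if_neg h.le.not_gt, if_neg (Nat.add_le_add_left h.le _).not_gt]
              omega)
          (by rw [subst_outPos, subst_inPos, subst_inPos, subst_outPos]), tr_tr, tr_tr, tr_tr]
  · funext q hq
    rw [out, fill_ne _ _ _ _ (outPos_ne_inPos i q hq l), out, out,
      push_eqToHom (subst_seq c i d l e) v
        (outPos _ (inPos c i d l) e (outPos c i d q hq) (outPos_ne_inPos i q hq l))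
        (outPos c i (d.subst l e) q hq)
        (by
          have := Fin.val_ne_of_ne hq
          have hl := l.2
          simp only [outPos_val, inPos_val]
          split_ifs <;> omega)
        (by rw [subst_outPos, subst_outPos, subst_outPos]), tr_tr, tr_tr]

theorem comp_par {c d e : SMon C} {x : C} (i j : Fin c.len) (h : i ≠ j) (α : Op A c x)
    (β : Op A d (c.col j)) (γ : Op A e (c.col i)) :
    compHom (outPos c j d i h) (compHom j α β)
        (actHom (eqToHom rfl) (eqToHom (subst_outPos c j d i h).symm) γ) =
      actHom (eqToHom (subst_par c i j h d e)) (eqToHom rfl)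
        (compHom (outPos c i e j h.symm) (compHom i α γ)
          (actHom (eqToHom rfl) (eqToHom (subst_outPos c i e j h.symm).symm) β)) := by
  ext v
  change α (fill j (β (inn j (fill (outPos c j d i h) (tr A _ (γ (push (𝟙 e) (inn _ v))))
      (out _ v)))) (out j (fill (outPos c j d i h) (tr A _ (γ (push (𝟙 e) (inn _ v)))) (out _ v)))) =
    tr A rfl (α (fill i (γ (inn i (fill (outPos c i e j h.symm)
      (tr A _ (β (push (𝟙 d) (inn _ (push (eqToHom (subst_par c i j h d e)) v)))))
      (out _ (push (eqToHom (subst_par c i j h d e)) v)))))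
      (out i (fill (outPos c i e j h.symm)
      (tr A _ (β (push (𝟙 d) (inn _ (push (eqToHom (subst_par c i j h d e)) v)))))
      (out _ (push (eqToHom (subst_par c i j h d e)) v))))))
  rw [tr_rfl, push_id, push_id]
  have hij := Fin.val_ne_of_ne h
  have hi := i.2
  have hj := j.2
  congr 1
  funext q
  by_cases hqj : q = j
  · subst hqj
    rw [fill_same, fill_ne _ _ _ _ h.symm, out, fill_same, tr_tr, tr_rfl]
    congr 1
    funext l
    rw [inn, inn, fill_ne _ _ _ _ (outPos_ne_inPos q i h l).symm, out,
      push_eqToHom (subst_par c i q h d e) v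
        (outPos _ (outPos c q d i h) e (inPos c q d l) (outPos_ne_inPos q i h l).symm)
        (inPos _ (outPos c i e q h.symm) d l)
        (by
          have hl := l.2
          simp only [outPos_val, inPos_val]
          split_ifs <;> omega)
        (by rw [subst_outPos, subst_inPos, subst_inPos]), tr_tr, tr_tr]
  · rw [fill_ne _ _ _ _ hqj, out]
    by_cases hqi : q = i
    · subst hqi
      rw [fill_same, fill_same, tr_tr, tr_rfl]
      congr 1
      funext l
      rw [inn, inn, fill_ne _ _ _ _ (outPos_ne_inPos q j h.symm l).symm, out,
        push_eqToHom (subst_par c q j h d e) v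
          (inPos _ (outPos c j d q h) e l)
          (outPos _ (outPos c q e j h.symm) d (inPos c q e l)
            (outPos_ne_inPos q j h.symm l).symm)
          (by
            have hl := l.2
            simp only [outPos_val, inPos_val]
            split_ifs <;> omega)
          (by rw [subst_inPos, subst_outPos, subst_inPos]), tr_tr, tr_tr]
    · have n₁ : outPos c j d q hqj ≠ outPos c j d i h := fun e' =>
        hqi (outPos_injective _ _ _ _ _ e')
      have n₂ : outPos c i e q hqi ≠ outPos c i e j h.symm := fun e' =>
        hqj (outPos_injective _ _ _ _ _ e')
      rw [fill_ne _ _ _ _ n₁, fill_ne _ _ _ _ hqi, out, out, fill_ne _ _ _ _ n₂, out,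
        push_eqToHom (subst_par c i j h d e) v
          (outPos _ (outPos c j d i h) e (outPos c j d q hqj) n₁)
          (outPos _ (outPos c i e j h.symm) d (outPos c i e q hqi) n₂)
          (by
            have h₁ := Fin.val_ne_of_ne hqi
            have h₂ := Fin.val_ne_of_ne hqj
            simp only [outPos_val]
            split_ifs <;> omega)
          (by rw [subst_outPos, subst_outPos, subst_outPos, subst_outPos]), tr_tr, tr_tr, tr_tr]

end EndOp

/-- The collection underlying the endomorphism operad of `A`. -/
def endColl : Coll k C where
  obj Z := ModuleCat.of k (EndOp.Op A Z.1.unop Z.2)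
  map f := ModuleCat.ofHom (EndOp.actHom f.1.unop f.2)
  map_id Z := by
    refine ModuleCat.hom_ext (LinearMap.ext fun α => MultilinearMap.ext fun v => ?_)
    change (A.map (𝟙 Z.2)).hom (α (EndOp.push (𝟙 Z.1.unop) v)) = α v
    rw [EndOp.push_id]
    simp
  map_comp {Z W V} f g := by
    refine ModuleCat.hom_ext (LinearMap.ext fun α => MultilinearMap.ext fun v => ?_)
    change (A.map (f.2 ≫ g.2)).hom (α (EndOp.push (g.1.unop ≫ f.1.unop) v)) =
      (A.map g.2).hom ((A.map f.2).hom (α (EndOp.push f.1.unop (EndOp.push g.1.unop v))))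
    rw [EndOp.push_push]
    simp

/-- The endomorphism operad of a functor `A : C ⥤ Vect`. -/
def endOperad : COperad k C where
  coll := endColl A
  comp i := EndOp.compHom i
  comp_natural {_ _ c c' d d'} _ _ f u i g α β :=
    (EndOp.comp_act (SMon.ofPi f) u i (SMon.ofPi g) (𝟙 (c i)) α β).trans (by
      rw [Category.id_comp]
      rfl)
  comp_equivariant {_ _ c d} x σ i τ α β :=
    (EndOp.comp_act (SMon.ofPerm σ c) (𝟙 x) i (SMon.ofPerm τ d) (𝟙 (c (σ i))) α β).trans (by
      rw [Category.id_comp]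
      change EndOp.actHom _ _ (EndOp.compHom (c := ⟨_, c⟩) (σ i) α
        ((endColl A).act (𝟙 (⟨_, d⟩ : SMon C)) (𝟙 (c (σ i))) β)) = _
      rw [Coll.act_id]
      rfl)
  comp_seq i l α β γ := EndOp.comp_seq i l α β γ
  comp_par i j h α β γ := EndOp.comp_par i j h α β γ

/-- An algebra of a `C`-operad `P`: a functor `A : C ⥤ Vect` with a morphism of `C`-operads
`P ⟶ End_A`. -/
structure Alg (P : COperad k C) : Type (u + 1) where
  obj : C ⥤ ModuleCat.{u} k
  str : P ⟶ endOperad obj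

namespace Alg

variable {P : COperad k C}

/-- The value `α(p)(v₁, …, vₙ)` of an operation on vectors of an algebra. -/
def eval (M : Alg P) {c : SMon C} {x : C} (p : P.val c x) (v : ∀ i, M.obj.obj (c.col i)) :
    M.obj.obj x :=
  let ϕ : EndOp.Op M.obj c x := (M.str.toNat.app (op c, x)).hom p
  ϕ v

/-- A morphism of algebras: a natural transformation which commutes with all operations. -/
@[ext]
structure Hom (M N : Alg P) : Type u where
  nat : M.obj ⟶ N.obj
  map_eval {c : SMon C} {x : C} (p : P.val c x) (v : ∀ i, M.obj.obj (c.col i)) :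
    (nat.app x).hom (M.eval p v) = N.eval p fun i => (nat.app (c.col i)).hom (v i)

instance : LargeCategory (Alg P) where
  Hom := Hom
  id M := ⟨𝟙 M.obj, fun _ _ => rfl⟩
  comp f g := ⟨f.nat ≫ g.nat, fun p v =>
    (congrArg (fun a => (g.nat.app _).hom a) (f.map_eval p v)).trans (g.map_eval p _)⟩
  id_comp _ := Hom.ext (Category.id_comp _)
  comp_id _ := Hom.ext (Category.comp_id _)
  assoc _ _ _ := Hom.ext (Category.assoc _ _ _)

variable (P) in
/-- The underlying functor of an algebra. -/
def forget : Alg P ⥤ (C ⥤ ModuleCat.{u} k) where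
  obj M := M.obj
  map f := Hom.nat f

end Alg

end End

/-! ### The hyperoperad -/

section Quotients

variable {k : Type u} [Field k] {J : Type u} [SmallCategory J] (F : J ⥤ ModuleCat.{u} k)

/-- The subfunctor of `F` generated by given elements. -/
def relSubmodule (R : ∀ Z, Set (F.obj Z)) (Z : J) : Submodule k (F.obj Z) :=
  Submodule.span k {a | ∃ (W : J) (f : W ⟶ Z) (r : F.obj W), r ∈ R W ∧ (F.map f).hom r = a}

theorem relSubmodule_map (R : ∀ Z, Set (F.obj Z)) {Z W : J} (f : Z ⟶ W) :
    relSubmodule F R Z ≤ (relSubmodule F R W).comap (F.map f).hom := by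
  rw [relSubmodule, Submodule.span_le]
  rintro _ ⟨V, g, r, hr, rfl⟩
  exact Submodule.subset_span ⟨V, g ≫ f, r, hr, by simp⟩

/-- The quotient of `F` by the equivalence relation `a ~ b` generated (compatibly with the linear
structure) by the pairs with `a - b ∈ R`. -/
def quotFunctor (R : ∀ Z, Set (F.obj Z)) : J ⥤ ModuleCat.{u} k where
  obj Z := ModuleCat.of k (F.obj Z ⧸ relSubmodule F R Z)
  map f := ModuleCat.ofHom (Submodule.mapQ _ _ (F.map f).hom (relSubmodule_map F R f))
  map_id Z := by
    ext a
    exact congrArg Submodule.Quotient.mk (congrArg (fun f => f.hom a) (F.map_id Z))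
  map_comp f g := by
    ext a
    exact congrArg Submodule.Quotient.mk (congrArg (fun f => f.hom a) (F.map_comp f g))

end Quotients

section Hyper

variable (k : Type u) [Field k] (C : Type u) [SmallCategory C]

/-- The data of a symbol `*ᵢᶠ`: two bouquets `(c₁ … cₙ; x)` and `(d₁ … dₘ; y)`, a position `i` and
a morphism `f : y ⟶ cᵢ`. -/
structure Symb : Type u where
  c : SMon C
  x : C
  i : Fin c.len
  d : SMon C
  y : C
  f : y ⟶ c.col i

variable {C}

/-- The inputs of a symbol `*ᵢᶠ`. -/
def Symb.source (s : Symb C) : Fin 2 → Bq C := ![(op s.c, s.x), (op s.d, s.y)]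

/-- The output of a symbol `*ᵢᶠ`. -/
def Symb.target (s : Symb C) : Bq C := (op (s.c.subst s.i s.d), s.x)

variable (C)

/-- The elements `(*ᵢᶠ, Φ₁ Φ₂; Ω)` with given inputs and output: a symbol with morphisms of bouquets
`Φ₁, Φ₂` attached to its inputs and `Ω` attached to its output. -/
abbrev SymbAt (Z : (Fin 2 → Bq C)ᵒᵖ × Bq C) : Type u :=
  Σ s : Symb C, ((op s.source, s.target) ⟶ Z)

/-- The left Kan extension, along the inclusion of the discrete category of objects, of the
collection of vector spaces spanned by the symbols `*ᵢᶠ`: it has the elements `(*ᵢᶠ, Φ₁ Φ₂; Ω)` as a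
basis. -/
noncomputable def symbColl : (Fin 2 → Bq C)ᵒᵖ × Bq C ⥤ ModuleCat.{u} k where
  obj Z := ModuleCat.of k (SymbAt C Z →₀ k)
  map f := ModuleCat.ofHom (Finsupp.lmapDomain k k fun a => ⟨a.1, a.2 ≫ f⟩)
  map_id Z := by
    refine ModuleCat.hom_ext (Finsupp.lhom_ext fun a r => ?_)
    simp [Finsupp.mapDomain_single]
  map_comp f g := by
    refine ModuleCat.hom_ext (Finsupp.lhom_ext fun a r => ?_)
    simp [Finsupp.mapDomain_single]

variable {C}

/-- A pair of morphisms of bouquets, as a morphism of pairs of bouquets. -/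
def pairHom {a a' b b' : Bq C} (Φ : a ⟶ a') (Ψ : b ⟶ b') :
    (![a, b] : Fin 2 → Bq C) ⟶ ![a', b'] := fun j =>
  match j with
  | 0 => Φ
  | 1 => Ψ

/-- The basis element `(*ᵢᶠ, Φ₁ Φ₂; Ω)`, for `s = *ᵢᶠ`, `Φ = (Φ₁, Φ₂)`. -/
noncomputable def symbElt (s : Symb C) {a : Fin 2 → Bq C} {b : Bq C} (Φ : a ⟶ s.source)
    (Ω : s.target ⟶ b) : (symbColl k C).obj (op a, b) :=
  Finsupp.single (⟨s, (Φ.op, Ω)⟩ : SymbAt C (op a, b)) 1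

/-- The `C`-equivariance relations
`(*ᵢʰ, (φ; u) (ψ; v); 1) ~ (*_{σ i}^{fᵢ h v}, 1 1; (φ ∘ᵢ ψ; u))` for `φ = (σ, f₁ … fₙ)`. -/
inductive EquivariantRel : ∀ Z : (Fin 2 → Bq C)ᵒᵖ × Bq C, (symbColl k C).obj Z → Prop
  | mk {c c' d d' : SMon C} {x x' y y' : C} (φ : c ⟶ c') (u : x' ⟶ x) (i : Fin c.len)
      (ψ : d ⟶ d') (v : y' ⟶ y) (h : y ⟶ c.col i) :
      EquivariantRel (op ![(op c', x'), (op d', y')], (op (c.subst i d), x))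
        (symbElt k ⟨c, x, i, d, y, h⟩
            (pairHom (a := (op c', x')) (a' := (op c, x)) (b := (op d', y')) (b' := (op d, y))
              (φ.op, u) (ψ.op, v))
            (𝟙 (op (c.subst i d), x)) -
          symbElt k ⟨c', x', SMon.perm φ i, d', y', v ≫ h ≫ SMon.app φ i⟩
            (𝟙 ![(op c', x'), (op d', y')])
            (Prod.mkHom (SMon.insert φ i ψ).op u))

variable (C)

/-- The generating collection `Q` of the hyperoperad: the symbols `*ᵢᶠ` with free actions on the
inputs and the output, modulo `C`-equivariance. It is concentrated in arity `2`. -/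
noncomputable def hyperGen : NSColl k (Bq C)
  | 2 => quotFunctor (symbColl k C) fun Z => {a | EquivariantRel k Z a}
  | _ => (Functor.const _).obj (ModuleCat.of k PUnit)

variable {C}

/-- The class of the symbol `*ᵢᶠ` in the free operad on `Q`. -/
noncomputable def star (c : SMon C) (x : C) (i : Fin c.len) (d : SMon C) (y : C)
    (f : y ⟶ c.col i) : (freeOperad (hyperGen k C)).val ⟨2, ![(op c, x), (op d, y)]⟩
      (op (c.subst i d), x) :=
  freeGen (hyperGen k C) (n := 2) (c := ![(op c, x), (op d, y)]) (x := (op (c.subst i d), x))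
    (Submodule.Quotient.mk (p := relSubmodule (symbColl k C) _ _)
      (symbElt k ⟨c, x, i, d, y, f⟩ (𝟙 ![(op c, x), (op d, y)]) (𝟙 (op (c.subst i d), x))))

theorem subst_zero_pair {D : Type u} (p a b e : D) :
    (⟨2, ![p, e]⟩ : SMon D).subst (0 : Fin 2) ⟨2, ![a, b]⟩ = ⟨3, ![a, b, e]⟩ :=
  SMon.ext_entry rfl fun q => by
    rw [SMon.entry_subst]
    rcases q with _ | _ | _ | q <;> simp [SMon.entry]

theorem subst_one_pair {D : Type u} (p a b e : D) :
    (⟨2, ![a, p]⟩ : SMon D).subst (1 : Fin 2) ⟨2, ![b, e]⟩ = ⟨3, ![a, b, e]⟩ :=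
  SMon.ext_entry rfl fun q => by
    rw [SMon.entry_subst]
    rcases q with _ | _ | _ | q <;> simp [SMon.entry]

theorem swap_triple {D : Type u} (a b e : D) :
    (⟨3, fun j => (![a, e, b] : Fin 3 → D) (Equiv.swap 1 2 j)⟩ : SMon D) = ⟨3, ![a, b, e]⟩ := by
  congr
  funext j
  fin_cases j <;> rfl

/-- The composite `s ∘₁ t` of binary operations, as an operation with inputs `a, b, e`. -/
def compOne {D : Type u} [SmallCategory D] (P : COperad k D) {a b e p x : D}
    (s : P.val ⟨2, ![p, e]⟩ x) (t : P.val ⟨2, ![a, b]⟩ p) : P.val ⟨3, ![a, b, e]⟩ x :=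
  P.coll.cast (subst_zero_pair p a b e) rfl
    (P.comp (c := ⟨2, ![p, e]⟩) (d := ⟨2, ![a, b]⟩) (0 : Fin 2) s t)

/-- The composite `s ∘₂ t` of binary operations, as an operation with inputs `a, b, e`. -/
def compTwo {D : Type u} [SmallCategory D] (P : COperad k D) {a b e p x : D}
    (s : P.val ⟨2, ![a, p]⟩ x) (t : P.val ⟨2, ![b, e]⟩ p) : P.val ⟨3, ![a, b, e]⟩ x :=
  P.coll.cast (subst_one_pair p a b e) rfl
    (P.comp (c := ⟨2, ![a, p]⟩) (d := ⟨2, ![b, e]⟩) (1 : Fin 2) s t)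

/-- The map which swaps the second and the third input. -/
def swapInputs {D : Type u} [SmallCategory D] (P : COperad k D) {a b e x : D}
    (s : P.val ⟨3, ![a, e, b]⟩ x) : P.val ⟨3, ![a, b, e]⟩ x :=
  P.coll.cast (swap_triple a b e) rfl
    (P.coll.act (SMon.ofPerm (Equiv.swap (1 : Fin 3) 2) ![a, e, b]) (𝟙 x) s)

/-- The `C`-associative relations: the sequential associators
`*ᵢ'ᵍ ∘₁ *ᵢᶠ - *ᵢᶠ ∘₂ *ₗᵍ` and the parallel associators
`*ᵢ'ᵍ ∘₁ *ⱼᶠ - τ(*ⱼ'ᶠ ∘₁ *ᵢᵍ)`, `i ≠ j`. -/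
inductive AssociativeRel :
    ∀ (b : SMon (Bq C)) (z : Bq C), (freeOperad (hyperGen k C)).val b z → Prop
  | seq (c : SMon C) (x : C) (i : Fin c.len) (d : SMon C) (y : C) (l : Fin d.len) (e : SMon C)
      (z : C) (f : y ⟶ c.col i) (g : z ⟶ d.col l) :
      AssociativeRel ⟨3, ![(op c, x), (op d, y), (op e, z)]⟩
        (op ((c.subst i d).subst (SMon.inPos c i d l) e), x)
        (compOne k _
            (star k (c.subst i d) x (SMon.inPos c i d l) e z
              (g ≫ eqToHom (SMon.subst_inPos c i d l).symm))
            (star k c x i d y f) -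
          (freeOperad (hyperGen k C)).coll.cast rfl
            (congrArg (fun s => ((op s, x) : Bq C)) (SMon.subst_seq c i d l e).symm)
            (compTwo k _ (star k c x i (d.subst l e) y f) (star k d y l e z g)))
  | par (c : SMon C) (x : C) (i j : Fin c.len) (h : i ≠ j) (d : SMon C) (y : C) (e : SMon C)
      (z : C) (f : y ⟶ c.col j) (g : z ⟶ c.col i) :
      AssociativeRel ⟨3, ![(op c, x), (op d, y), (op e, z)]⟩
        (op ((c.subst j d).subst (SMon.outPos c j d i h) e), x)
        (compOne k _
            (star k (c.subst j d) x (SMon.outPos c j d i h) e z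
              (g ≫ eqToHom (SMon.subst_outPos c j d i h).symm))
            (star k c x j d y f) -
          (freeOperad (hyperGen k C)).coll.cast rfl
            (congrArg (fun s => ((op s, x) : Bq C)) (SMon.subst_par c i j h d e).symm)
            (swapInputs k _ (compOne k _
              (star k (c.subst i e) x (SMon.outPos c i e j h.symm) d y
                (f ≫ eqToHom (SMon.subst_outPos c i e j h.symm).symm))
              (star k c x i e z g))))

variable (C)

/-- The hyperoperad `ℍ_C = F(Q) / As`, an operad coloured by the category of bouquets. -/
noncomputable def hyperoperad : COperad k (Bq C) :=
  (freeOperad (hyperGen k C)).quot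
    (COperad.Ideal.span _ fun b z => {a | AssociativeRel k b z a})

end Hyper

end CatOperad

namespace CatOperad

/-! ### Functoriality of substitution in `𝕊 C` -/

namespace SMon

variable {C : Type u} [SmallCategory C]

/-! An algebra of `ℍ_C` is a functor `A` on bouquets, that is a `C`-collection, with a morphism `ℍ_C
⟶ End_A`. Since `ℍ_C = F(Q)/(As)`, such a morphism amounts to a choice of bilinear operations `*ᵢᶠ`
on `A` which satisfy `C`-equivariance and `C`-associativity. This universal property is
`HyperData.hom` (existence, built from `freeLift` and `liftSpan`) together with `hyper_hom_ext`
(uniqueness).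

It remains to see that these operations are the same thing as partial compositions on `A`.
Equivariance, applied to the morphism `(1; f)` of the second bouquet, gives `*ᵢᶠ(α, β) = *ᵢ¹(α, A(1;
f) β)` (`Alg.starMap_eq`), so everything is determined by `∘ᵢ := *ᵢ¹`. What is left of equivariance
says that `∘ᵢ` is compatible with arbitrary morphisms of `𝕊 C` in the inputs and of `C` in the
output and the connecting colour. As every morphism of `𝕊 C` factors as `(1, f₁ … fₙ)` followed by
`(σ, 1 … 1)`, and insertion of morphisms respects composition (`insert_comp`), this is equivalent to
the separate naturality and equivariance axioms of an operad (`COperad.comp_act`,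
`Alg.starMap_comp_act`). The two kinds of associators, evaluated on triples of vectors, become
sequential and parallel associativity.

Conversely, an operad acts by `*ᵢᶠ(α, β) = α ∘ᵢ P(1; f) β`. Neither construction changes the
underlying collection, and they are strictly inverse to each other. For morphisms, a natural
transformation compatible with the symbols is compatible with all operations, because the symbols
generate `ℍ_C` (`hyper_induction`). Both forgetful functors are faithful, so equality of the
composite functors with the identities needs only equality on objects and equality of the underlying
natural transformations.

Binary quadraticity can be read off the presentation: `Q` lives in arity `2`, and each associator is
a difference of composites of two symbols, up to actions of morphisms. -/

theorem hom_ext {c d : SMon C} {φ ψ : c ⟶ d} (h : ∀ p, perm φ p = perm ψ p)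
    (h' : ∀ p, app φ p ≍ app ψ p) : φ = ψ := by
  obtain ⟨σ, f⟩ := φ
  obtain ⟨τ, g⟩ := ψ
  obtain rfl : σ = τ := Equiv.ext h
  obtain rfl : f = g := funext fun p => eq_of_heq (h' p)
  rfl

/-- Heterogeneous equality absorbs the transport in the definition of `insert`. The free variable
`s` allows a case split into outer and inserted positions. -/
theorem app_insert_heq {c c' d d' : SMon C} (φ : c ⟶ c') (i : Fin c.len) (ψ : d ⟶ d')
    {p : Fin (c.subst i d).len} {s : {j : Fin c.len // j ≠ i} ⊕ Fin d.len} (h : split i p = s) :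
    app (insert φ i ψ) p ≍ insertApp φ i ψ s := by
  subst h
  exact comp_eqToHom_heq _ _

theorem split_perm_insert {c c' d d' : SMon C} (φ : c ⟶ c') (i : Fin c.len) (ψ : d ⟶ d')
    (p : Fin (c.subst i d).len) : split (perm φ i) (perm (insert φ i ψ) p) =
      Equiv.sumCongr ((perm φ).subtypeEquiv fun _ => not_congr (perm φ).injective.eq_iff.symm)
        (perm ψ) (split i p) :=
  (split (perm φ i)).apply_symm_apply _

theorem insert_id (c : SMon C) (i : Fin c.len) (d : SMon C) :
    insert (𝟙 c) i (𝟙 d) = 𝟙 (c.subst i d) := by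
  have hs : ∀ p, split i (perm (insert (𝟙 c) i (𝟙 d)) p) = split (m := d.len) i p := fun p => by
    refine (split_perm_insert (𝟙 c) i (𝟙 d) p).trans ?_
    rcases split (m := d.len) i p with j | l <;> rfl
  refine hom_ext (fun p => (split i).injective (hs p)) fun p => ?_
  refine (app_insert_heq (𝟙 c) i (𝟙 d) rfl).trans ?_
  change _ ≍ 𝟙 (Sum.elim (fun j : {j // j ≠ i} => c.col j.1) d.col (split i p))
  rcases split (m := d.len) i p with j | l <;> exact HEq.rfl

/-- After splitting positions into outer and inserted ones, insertion acts by `φ` on the first and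
by `ψ` on the second summand, and each of these composes separately. The second insertion takes
place at `perm φ i`, where the first one has moved the slot. -/
theorem insert_comp {c c' c'' d d' d'' : SMon C} (φ : c ⟶ c') (φ' : c' ⟶ c'') (i : Fin c.len)
    (ψ : d ⟶ d') (ψ' : d' ⟶ d'') :
    insert (φ ≫ φ') i (ψ ≫ ψ') = insert φ i ψ ≫ insert φ' (perm φ i) ψ' := by
  have hp : ∀ p, perm (insert (φ ≫ φ') i (ψ ≫ ψ')) p =
      perm (insert φ i ψ ≫ insert φ' (perm φ i) ψ') p := fun p => by
    refine (split (perm φ' (perm φ i))).injective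
      ((split_perm_insert (φ ≫ φ') i (ψ ≫ ψ') p).trans (Eq.trans ?_
        ((split_perm_insert φ' (perm φ i) ψ' _).trans
          (congrArg _ (split_perm_insert φ i ψ p))).symm))
    rcases split (m := d.len) i p with j | l <;> rfl
  refine hom_ext hp fun p => (app_insert_heq (φ ≫ φ') i (ψ ≫ ψ') rfl).trans (HEq.symm ?_)
  have h₁ := app_insert_heq φ i ψ (p := p) rfl
  have h₂ := app_insert_heq φ' (perm φ i) ψ' (split_perm_insert φ i ψ p)
  -- The factors agree only heterogeneously, since their middle and final objects are computed from
  -- differently expressed positions; `heq_comp` takes the equalities of these objects separately.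
  refine (heq_comp rfl (congrArg (Sum.elim (fun j : {j // j ≠ perm φ i} => c'.col j.1) d'.col)
    (split_perm_insert φ i ψ p)) ?_ h₁ h₂).trans ?_
  · exact congrArg (Sum.elim (fun j : {j // j ≠ perm φ' (perm φ i)} => c''.col j.1) d''.col)
      ((split_perm_insert φ' (perm φ i) ψ' _).trans (congrArg _ (split_perm_insert φ i ψ p)))
  · have key : ∀ s, insertApp φ i ψ s ≫ insertApp φ' (perm φ i) ψ' _ ≍
        insertApp (φ ≫ φ') i (ψ ≫ ψ') s := by
      rintro (j | l) <;> exact HEq.rfl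
    exact key _

/-- Every morphism of `𝕊 C` is of the form `(1, f₁ … fₙ)` followed by `(σ, 1 … 1)`. -/
theorem hom_induction {motive : ∀ {c c' : SMon C}, (c ⟶ c') → Prop}
    (h : ∀ {n : ℕ} {c c' : Fin n → C} (σ : Equiv.Perm (Fin n)) (f : ∀ i, c i ⟶ c' (σ i)),
      motive (ofPi f ≫ ofPerm σ c')) {c c' : SMon C} (φ : c ⟶ c') : motive φ := by
  obtain ⟨n, c⟩ := c
  obtain ⟨n', c'⟩ := c'
  obtain ⟨σ, f⟩ := φ
  -- A bijection of positions forces equal lengths, so `σ` becomes a permutation.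
  obtain rfl : n = n' := by simpa using Fintype.card_congr σ
  have := h σ f
  have e : (ofPi f ≫ ofPerm σ c' : SMon.mk n c ⟶ SMon.mk n c') = Hom.mk σ f :=
    hom_ext (fun _ => rfl) fun p => heq_of_eq (Category.comp_id (f p))
  exact e ▸ this

end SMon

open SMon

/-! ### Partial compositions and arbitrary morphisms of bouquets -/

namespace COperad

variable {k : Type u} [Field k] {C : Type u} [SmallCategory C]

/-- Naturality of `∘ᵢ` with respect to all morphisms of bouquets. -/
theorem comp_act (P : COperad k C) {c c' d d' : SMon C} {x x' y : C} (φ : c ⟶ c') (u : x ⟶ x')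
    (i : Fin c.len) (ψ : d ⟶ d') (v : y ⟶ c.col i) (α : P.val c' x) (β : P.val d' y) :
    P.comp i (P.coll.act φ u α) (P.coll.act ψ v β) =
      P.coll.act (insert φ i ψ) u
        (P.comp (perm φ i) α (P.coll.act (𝟙 d') (v ≫ app φ i) β)) := by
  induction φ using hom_induction with | @h n c c' σ f
  induction ψ using hom_induction with | @h m d d' τ g
  rw [insert_comp]
  -- With `φ = (1, f) ≫ (σ, 1)` and `ψ = (1, g) ≫ (τ, 1)`, naturality strips off the families `f`
  -- and `g`. The component `f i` at the slot cannot leave through the inputs and moves to the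
  -- output of `β`. Equivariance in `h₂` then strips off `σ` and `τ`.
  have h₁ := P.comp_natural f u i g (P.coll.act (ofPerm σ c') (𝟙 x) α)
    (P.coll.act (ofPerm τ d') v β)
  rw [Coll.act_act, Coll.act_act, Coll.act_act, Category.id_comp, Category.comp_id,
    Category.id_comp] at h₁
  have h₂ := P.comp_equivariant σ i τ α (P.coll.act (𝟙 _) (v ≫ f i) β)
  rw [Coll.act_act, Category.comp_id, Category.comp_id] at h₂
  have e : app (ofPi f ≫ ofPerm σ c' : SMon.mk n c ⟶ SMon.mk n c') i = f i :=
    Category.comp_id (f i)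
  refine h₁.trans ((congrArg _ h₂).trans ((Coll.act_act ..).trans ?_))
  rw [Category.id_comp]
  exact congrArg (fun g => P.coll.act _ u (P.comp (σ i) α (P.coll.act _ (v ≫ g) β))) e.symm

end COperad

end CatOperad

namespace CatOperad

open SMon

variable {k : Type u} [Field k] {C : Type u} [SmallCategory C]

/-! ### Universal properties of quotients and free operads -/

namespace COperad

namespace Hom

variable {P E : COperad k C}

/-- The components of a morphism of operads. -/
def lin (φ : P ⟶ E) (c : SMon C) (x : C) : P.val c x →ₗ[k] E.val c x :=
  ((Hom.toNat φ).app (op c, x)).hom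

theorem lin_act (φ : P ⟶ E) {c c' : SMon C} {x x' : C} (ψ : c ⟶ c') (u : x ⟶ x')
    (a : P.val c' x) : lin φ c x' (P.coll.act ψ u a) = E.coll.act ψ u (lin φ c' x a) :=
  congrArg (fun f => f.hom a)
    ((Hom.toNat φ).naturality (X := (op c', x)) (Y := (op c, x')) (ψ.op, u))

theorem lin_cast (φ : P ⟶ E) {c c' : SMon C} {x x' : C} (hc : c = c') (hx : x = x')
    (a : P.val c x) :
    lin φ c' x' (P.coll.cast hc hx a) = E.coll.cast hc hx (lin φ c x a) :=
  lin_act φ _ _ a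

theorem lin_comp (φ : P ⟶ E) {c d : SMon C} {x : C} (i : Fin c.len) (α : P.val c x)
    (β : P.val d (c.col i)) :
    lin φ _ x (P.comp i α β) = E.comp i (lin φ c x α) (lin φ d _ β) :=
  Hom.map_comp φ i α β

theorem ext_lin {φ ψ : P ⟶ E} (h : ∀ c x a, lin φ c x a = lin ψ c x a) : φ = ψ :=
  Hom.ext (NatTrans.ext (funext fun Z => ModuleCat.hom_ext (LinearMap.ext (h Z.1.unop Z.2))))

/-- A family of linear maps which commutes with the actions and with the compositions is a morphism
of operads. -/
def ofLin (f : ∀ c x, P.val c x →ₗ[k] E.val c x)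
    (hact : ∀ {c c' : SMon C} {x x' : C} (φ : c ⟶ c') (u : x ⟶ x') (a : P.val c' x),
      f c x' (P.coll.act φ u a) = E.coll.act φ u (f c' x a))
    (hcomp : ∀ {c d : SMon C} {x : C} (i : Fin c.len) (α : P.val c x) (β : P.val d (c.col i)),
      f _ x (P.comp i α β) = E.comp i (f c x α) (f d _ β)) : P ⟶ E where
  toNat :=
    { app := fun Z => ModuleCat.ofHom (f Z.1.unop Z.2)
      naturality := fun _ _ g => ModuleCat.hom_ext (LinearMap.ext fun a =>
        hact g.1.unop g.2 a) }
  map_comp i α β := hcomp i α β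

/-- The kernel of a morphism of operads. -/
def ker (φ : P ⟶ E) : P.Ideal where
  carrier c x := LinearMap.ker (lin φ c x)
  act_mem ψ u a ha := by
    rw [LinearMap.mem_ker] at ha ⊢
    rw [lin_act, ha, map_zero]
  comp_mem_left i a b ha := by
    rw [LinearMap.mem_ker] at ha ⊢
    rw [lin_comp, ha, map_zero, LinearMap.zero_apply]
  comp_mem_right i a b hb := by
    rw [LinearMap.mem_ker] at hb ⊢
    rw [lin_comp, hb, map_zero]

/-- The kernel of `φ` is one of the ideals whose intersection defines the span. -/
theorem lin_eq_zero_of_mem_span (φ : P ⟶ E) {A : ∀ (c : SMon C) (x : C), Set (P.val c x)}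
    (hA : ∀ c x, ∀ a ∈ A c x, lin φ c x a = 0) (c : SMon C) (x : C) (a : P.val c x)
    (ha : a ∈ (Ideal.span P A).carrier c x) : lin φ c x a = 0 :=
  Submodule.mem_sInf.1 ha _ ⟨ker φ, fun c x a h => hA c x a h, rfl⟩

/-- A morphism of operads which vanishes on `A` factors through the quotient by `(A)`. -/
def liftSpan (φ : P ⟶ E) (A : ∀ (c : SMon C) (x : C), Set (P.val c x))
    (hA : ∀ c x, ∀ a ∈ A c x, lin φ c x a = 0) : P.quot (Ideal.span P A) ⟶ E :=
  ofLin (fun c x => Submodule.liftQ _ (lin φ c x) (lin_eq_zero_of_mem_span φ hA c x))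
    (fun ψ u a => by
      obtain ⟨a, rfl⟩ := Submodule.Quotient.mk_surjective _ a
      exact lin_act φ ψ u a)
    (fun i a b => by
      obtain ⟨a, rfl⟩ := Submodule.Quotient.mk_surjective _ a
      obtain ⟨b, rfl⟩ := Submodule.Quotient.mk_surjective _ b
      exact lin_comp φ i a b)

end Hom

/-- The projection `P → P / I`. -/
def quotMk (P : COperad k C) (I : P.Ideal) : P ⟶ P.quot I :=
  Hom.ofLin (fun c x => (I.carrier c x).mkQ) (fun _ _ _ => rfl) (fun _ _ _ => rfl)

theorem quotMk_eq_zero_of_mem (P : COperad k C) {A : ∀ (c : SMon C) (x : C), Set (P.val c x)}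
    {c : SMon C} {x : C} {a : P.val c x} (h : a ∈ A c x) :
    Hom.lin (quotMk P (Ideal.span P A)) c x a = 0 := by
  refine (Submodule.Quotient.mk_eq_zero _).2 (Submodule.mem_sInf.2 ?_)
  rintro _ ⟨I, hI, rfl⟩
  exact hI c x h

end COperad

namespace FreeTerm

variable {X : NSColl k C} (E : COperad k C)
  (g : ∀ (n : ℕ) (c : Fin n → C) (x : C), (X n).obj (op c, x) →ₗ[k] E.val ⟨n, c⟩ x)

/-- The value of a formal expression in an operad which receives a map from the generators. -/
def eval : ∀ {c : SMon C} {x : C}, FreeTerm X c x → E.val c x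
  | _, _, gen a => g _ _ _ a
  | _, _, act φ u s => E.coll.act φ u (eval s)
  | _, _, comp i s t => E.comp i (eval s) (eval t)
  | _, _, zero => 0
  | _, _, add s t => eval s + eval t
  | _, _, smul r s => r • eval s

/-- Each generator of the congruence is an axiom of operads in vector spaces, hence holds in `E`, or
expresses linearity or naturality of the inclusion of `X`, hence holds by the assumptions on `g`. -/
theorem eval_eq_of_rel
    (hg : ∀ {n : ℕ} {c c' : Fin n → C} {x x' : C} (f : c ⟶ c') (u : x ⟶ x')
      (a : (X n).obj (op c', x)),
      g n c x' (((X n).map (X := (op c', x)) (Y := (op c, x')) (f.op, u)).hom a) =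
        E.coll.act (ofPi f) u (g n c' x a))
    {c : SMon C} {x : C} {s t : FreeTerm X c x} (h : Rel s t) : eval E g s = eval E g t := by
  induction h with
  | refl => rfl
  | symm _ ih => exact ih.symm
  | trans _ _ ih ih' => exact ih.trans ih'
  | act_congr φ u _ ih => exact congrArg (E.coll.act φ u) ih
  | comp_congr i _ _ ih ih' => simp only [eval, ih, ih']
  | add_congr _ _ ih ih' => simp only [eval, ih, ih']
  | smul_congr r _ ih => simp only [eval, ih]
  | add_assoc => exact _root_.add_assoc _ _ _
  | add_comm => exact _root_.add_comm _ _
  | zero_add => exact _root_.zero_add _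
  | zero_smul => exact _root_.zero_smul _ _
  | one_smul => exact _root_.one_smul _ _
  | mul_smul => exact SemigroupAction.mul_smul _ _ _
  | smul_add => exact _root_.smul_add _ _ _
  | add_smul => exact _root_.add_smul _ _ _
  | gen_add => exact map_add _ _ _
  | gen_smul => exact map_smul _ _ _
  | gen_natural f u a => exact hg f u a
  | act_add => exact map_add _ _ _
  | act_smul => exact map_smul _ _ _
  | act_id => exact Coll.act_id _ _
  | act_act => exact Coll.act_act _ _ _ _ _ _
  | comp_add_left => simp only [eval, map_add, LinearMap.add_apply]
  | comp_smul_left => simp only [eval, map_smul, LinearMap.smul_apply]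
  | comp_add_right => exact map_add _ _ _
  | comp_smul_right => exact map_smul _ _ _
  | comp_natural f u i g' s t => exact E.comp_natural f u i g' _ _
  | comp_equivariant σ i τ s t => exact E.comp_equivariant σ i τ _ _
  | comp_seq i l s t r => exact E.comp_seq i l _ _ _
  | comp_par i j h s t r => exact E.comp_par i j h _ _ _

end FreeTerm

/-- The morphism out of the free operad induced by a map on the generators. -/
def freeLift {X : NSColl k C} (E : COperad k C)
    (g : ∀ (n : ℕ) (c : Fin n → C) (x : C), (X n).obj (op c, x) →ₗ[k] E.val ⟨n, c⟩ x)
    (hg : ∀ {n : ℕ} {c c' : Fin n → C} {x x' : C} (f : c ⟶ c') (u : x ⟶ x')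
      (a : (X n).obj (op c', x)),
      g n c x' (((X n).map (X := (op c', x)) (Y := (op c, x')) (f.op, u)).hom a) =
        E.coll.act (ofPi f) u (g n c' x a)) : freeOperad X ⟶ E :=
  COperad.Hom.ofLin
    (fun c x =>
      { toFun := Quotient.lift (FreeTerm.eval E g) fun _ _ => FreeTerm.eval_eq_of_rel E g hg
        map_add' := by
          rintro ⟨s⟩ ⟨t⟩
          rfl
        map_smul' := by
          rintro r ⟨s⟩
          rfl })
    (by
      rintro _ _ _ _ φ u ⟨s⟩
      rfl)
    (by
      rintro _ _ _ i ⟨s⟩ ⟨t⟩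
      rfl)

/-- Induction over the free operad. -/
theorem free_induction {X : NSColl k C}
    {motive : ∀ (c : SMon C) (x : C), (freeOperad X).val c x → Prop}
    (gen : ∀ {n : ℕ} {c : Fin n → C} {x : C} (a : (X n).obj (op c, x)), motive _ _ (freeGen X a))
    (act : ∀ {c c' : SMon C} {x x' : C} (φ : c ⟶ c') (u : x ⟶ x') (a : (freeOperad X).val c' x),
      motive _ _ a → motive _ _ ((freeOperad X).coll.act φ u a))
    (comp : ∀ {c d : SMon C} {x : C} (i : Fin c.len) (a : (freeOperad X).val c x)
      (b : (freeOperad X).val d (c.col i)), motive _ _ a → motive _ _ b →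
        motive _ _ ((freeOperad X).comp i a b))
    (zero : ∀ c x, motive c x 0)
    (add : ∀ {c x} (a b : (freeOperad X).val c x), motive _ _ a → motive _ _ b → motive _ _ (a + b))
    (smul : ∀ {c x} (r : k) (a : (freeOperad X).val c x), motive _ _ a → motive _ _ (r • a))
    {c : SMon C} {x : C} (a : (freeOperad X).val c x) : motive c x a := by
  refine Quotient.ind (motive := motive c x) (fun s : FreeTerm X c x => ?_) a
  clear a
  induction s with
  | gen a => exact gen a
  | act φ u s ih => exact act φ u _ ih
  | comp i s t ih ih' => exact comp i _ _ ih ih'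
  | zero => exact zero _ _
  | add s t ih ih' => exact add _ _ ih ih'
  | smul r s ih => exact smul r _ ih

end CatOperad

namespace CatOperad

open SMon

variable {k : Type u} [Field k] {C : Type u} [SmallCategory C]

/-! ### Evaluation of binary and ternary operations in endomorphism operads -/

namespace EndOp

variable {A B : C ⥤ ModuleCat.{u} k}

theorem push_ofPi {n : ℕ} {c c' : Fin n → C} (f : ∀ i, c i ⟶ c' i) (v : Tup A ⟨n, c⟩) (p : Fin n) :
    push (ofPi f) v p = (A.map (f p)).hom (v p) :=
  push_perm (ofPi f) v p

/-- A pair of vectors. -/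
def pair {a b : C} (v : A.obj a) (w : A.obj b) : Tup A ⟨2, ![a, b]⟩ := fun j =>
  match j with
  | 0 => v
  | 1 => w

/-- A triple of vectors. -/
def triple {a b e : C} (u : A.obj a) (v : A.obj b) (w : A.obj e) : Tup A ⟨3, ![a, b, e]⟩ := fun j =>
  match j with
  | 0 => u
  | 1 => v
  | 2 => w

theorem pair_eta {a b : C} (v : Tup A ⟨2, ![a, b]⟩) :
    pair (a := a) (b := b) (v (0 : Fin 2)) (v (1 : Fin 2)) = v := by
  funext j
  change Fin 2 at j
  fin_cases j <;> rfl

theorem triple_eta {a b e : C} (v : Tup A ⟨3, ![a, b, e]⟩) :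
    triple (a := a) (b := b) (e := e) (v (0 : Fin 3)) (v (1 : Fin 3)) (v (2 : Fin 3)) = v := by
  funext j
  change Fin 3 at j
  fin_cases j <;> rfl

theorem update_pair_zero {a b : C} (v v' : A.obj a) (w : A.obj b) :
    Function.update (pair v w) (0 : Fin 2) v' = pair v' w := by
  funext j
  change Fin 2 at j
  fin_cases j <;> rfl

theorem update_pair_one {a b : C} (v : A.obj a) (w w' : A.obj b) :
    Function.update (pair v w) (1 : Fin 2) w' = pair v w' := by
  funext j
  change Fin 2 at j
  fin_cases j <;> rfl

/-- A binary operation as a bilinear map. -/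
def toBilin {a b x : C} (α : Op A ⟨2, ![a, b]⟩ x) : A.obj a →ₗ[k] A.obj b →ₗ[k] A.obj x :=
  LinearMap.mk₂ k (fun v w => α (pair v w))
    (fun v v' w =>
      -- Multilinearity is stated through updates of a tuple; the entry `0` is an arbitrary value
      -- that gets overwritten.
      have h z := congrArg α (update_pair_zero 0 z w)
      (h _).symm.trans ((α.map_update_add (pair 0 w) (0 : Fin 2) v v').trans
        (congrArg₂ (· + ·) (h v) (h v'))))
    (fun r v w =>
      have h z := congrArg α (update_pair_zero 0 z w)
      (h _).symm.trans ((α.map_update_smul (pair 0 w) (0 : Fin 2) r v).trans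
        (congrArg (r • ·) (h v))))
    (fun v w w' =>
      have h z := congrArg α (update_pair_one v 0 z)
      (h _).symm.trans ((α.map_update_add (pair v 0) (1 : Fin 2) w w').trans
        (congrArg₂ (· + ·) (h w) (h w'))))
    (fun r v w =>
      have h z := congrArg α (update_pair_one v 0 z)
      (h _).symm.trans ((α.map_update_smul (pair v 0) (1 : Fin 2) r w).trans
        (congrArg (r • ·) (h w))))

/-- A bilinear map as a binary operation. -/
def ofBilin {a b x : C} (μ : A.obj a →ₗ[k] A.obj b →ₗ[k] A.obj x) : Op A ⟨2, ![a, b]⟩ x where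
  toFun v := μ (v (0 : Fin 2)) (v (1 : Fin 2))
  map_update_add' := by
    intro inst v p s t
    change Fin 2 at p
    -- The multilinearity fields quantify over all decidability instances; fixing the standard one
    -- lets the updates compute.
    obtain rfl : inst = instDecidableEqFin 2 := Subsingleton.elim _ _
    fin_cases p
    · exact LinearMap.congr_fun (map_add μ s t) (v (1 : Fin 2))
    · exact map_add (μ (v (0 : Fin 2))) s t
  map_update_smul' := by
    intro inst v p r s
    change Fin 2 at p
    obtain rfl : inst = instDecidableEqFin 2 := Subsingleton.elim _ _
    fin_cases p
    · exact LinearMap.congr_fun (map_smul μ r s) (v (1 : Fin 2))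
    · exact map_smul (μ (v (0 : Fin 2))) r s

/-- In the substituted list the inserted block occupies positions `0, 1` and the old second entry
moves to `2`. What remains are transports along equalities of colours, which cancel in pairs. -/
theorem compOne_apply {a b e p x : C} (s : Op A ⟨2, ![p, e]⟩ x) (t : Op A ⟨2, ![a, b]⟩ p)
    (u : A.obj a) (v : A.obj b) (w : A.obj e) :
    (show Op A ⟨3, ![a, b, e]⟩ x from compOne k (endOperad A) s t) (triple u v w) =
      s (pair (t (pair u v)) w) := by
  change tr A rfl (s (fill (c := ⟨2, ![p, e]⟩) (0 : Fin 2)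
    (t (inn (c := ⟨2, ![p, e]⟩) (d := ⟨2, ![a, b]⟩) (0 : Fin 2)
      (push (eqToHom (subst_zero_pair p a b e).symm) (triple u v w))))
    (out (c := ⟨2, ![p, e]⟩) (d := ⟨2, ![a, b]⟩) (0 : Fin 2)
      (push (eqToHom (subst_zero_pair p a b e).symm) (triple u v w))))) = _
  rw [tr_rfl]
  congr 1
  funext j
  change Fin 2 at j
  fin_cases j
  · refine (fill_same (c := ⟨2, ![p, e]⟩) (0 : Fin 2) _ _).trans (congrArg t ?_)
    funext l
    change Fin 2 at l
    fin_cases l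
    · exact (congrArg _ (push_eqToHom (subst_zero_pair p a b e).symm _ (0 : Fin 3) _ rfl rfl)).trans
        ((tr_tr ..).trans (tr_rfl ..))
    · exact (congrArg _ (push_eqToHom (subst_zero_pair p a b e).symm _ (1 : Fin 3) _ rfl rfl)).trans
        ((tr_tr ..).trans (tr_rfl ..))
  · refine (fill_ne (c := ⟨2, ![p, e]⟩) (0 : Fin 2) _ _ (1 : Fin 2) one_ne_zero).trans ?_
    exact (congrArg _ (push_eqToHom (subst_zero_pair p a b e).symm _ (2 : Fin 3) _ rfl rfl)).trans
        ((tr_tr ..).trans (tr_rfl ..))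

theorem compTwo_apply {a b e p x : C} (s : Op A ⟨2, ![a, p]⟩ x) (t : Op A ⟨2, ![b, e]⟩ p)
    (u : A.obj a) (v : A.obj b) (w : A.obj e) :
    (show Op A ⟨3, ![a, b, e]⟩ x from compTwo k (endOperad A) s t) (triple u v w) =
      s (pair u (t (pair v w))) := by
  change tr A rfl (s (fill (c := ⟨2, ![a, p]⟩) (1 : Fin 2)
    (t (inn (c := ⟨2, ![a, p]⟩) (d := ⟨2, ![b, e]⟩) (1 : Fin 2)
      (push (eqToHom (subst_one_pair p a b e).symm) (triple u v w))))
    (out (c := ⟨2, ![a, p]⟩) (d := ⟨2, ![b, e]⟩) (1 : Fin 2)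
      (push (eqToHom (subst_one_pair p a b e).symm) (triple u v w))))) = _
  rw [tr_rfl]
  congr 1
  funext j
  change Fin 2 at j
  fin_cases j
  · refine (fill_ne (c := ⟨2, ![a, p]⟩) (1 : Fin 2) _ _ (0 : Fin 2) zero_ne_one).trans ?_
    exact (congrArg _ (push_eqToHom (subst_one_pair p a b e).symm _ (0 : Fin 3) _ rfl rfl)).trans
        ((tr_tr ..).trans (tr_rfl ..))
  · refine (fill_same (c := ⟨2, ![a, p]⟩) (1 : Fin 2) _ _).trans (congrArg t ?_)
    funext l
    change Fin 2 at l
    fin_cases l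
    · exact (congrArg _ (push_eqToHom (subst_one_pair p a b e).symm _ (1 : Fin 3) _ rfl rfl)).trans
        ((tr_tr ..).trans (tr_rfl ..))
    · exact (congrArg _ (push_eqToHom (subst_one_pair p a b e).symm _ (2 : Fin 3) _ rfl rfl)).trans
        ((tr_tr ..).trans (tr_rfl ..))

theorem swapInputs_apply {a b e x : C} (s : Op A ⟨3, ![a, e, b]⟩ x)
    (u : A.obj a) (v : A.obj b) (w : A.obj e) :
    (show Op A ⟨3, ![a, b, e]⟩ x from swapInputs k (endOperad A) s) (triple u v w) =
      s (triple u w v) := by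
  change tr A rfl ((A.map (𝟙 x)).hom (s (push (ofPerm (Equiv.swap (1 : Fin 3) 2) ![a, e, b])
    (push (eqToHom (swap_triple a b e).symm) (triple u v w))))) = _
  rw [tr_rfl, push_push, A.map_id]
  change s _ = _
  congr 1
  -- Comparing entries at the images of the positions `j` under the swap avoids the inverse
  -- permutation in `push`.
  refine tup_ext (ofPerm (Equiv.swap (1 : Fin 3) 2) ![a, e, b]) fun j => ?_
  rw [← push_push, push_perm]
  change (A.map (𝟙 _)).hom _ = _
  rw [A.map_id]
  change push _ _ j = _
  change Fin 3 at j
  fin_cases j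
  · exact (push_eqToHom (swap_triple a b e).symm _ (0 : Fin 3) _ rfl rfl).trans (tr_rfl ..)
  · exact (push_eqToHom (swap_triple a b e).symm _ (1 : Fin 3) _ rfl rfl).trans (tr_rfl ..)
  · exact (push_eqToHom (swap_triple a b e).symm _ (2 : Fin 3) _ rfl rfl).trans (tr_rfl ..)

/-! ### Operations compatible with a natural transformation -/

/-- Two operations correspond to each other under a natural transformation. -/
def Respects (η : A ⟶ B) {c : SMon C} {x : C} (α : Op A c x) (β : Op B c x) : Prop :=
  ∀ v, (η.app x).hom (α v) = β fun i => (η.app (c.col i)).hom (v i)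

theorem nat_tr (η : A ⟶ B) {x y : C} (h : x = y) (a : A.obj x) :
    (η.app y).hom (tr A h a) = tr B h ((η.app x).hom a) := by
  subst h
  rw [tr_rfl, tr_rfl]

theorem nat_map (η : A ⟶ B) {x y : C} (f : x ⟶ y) (a : A.obj x) :
    (η.app y).hom ((A.map f).hom a) = (B.map f).hom ((η.app x).hom a) :=
  congrArg (fun g => g.hom a) (η.naturality f)

theorem Respects.act {η : A ⟶ B} {c c' : SMon C} {x x' : C} (φ : c ⟶ c') (u : x ⟶ x')
    {α : Op A c' x} {β : Op B c' x} (h : Respects η α β) :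
    Respects η (actHom φ u α) (actHom φ u β) := fun v => by
  rw [actHom_apply, actHom_apply, nat_map, h]
  congr 2
  refine tup_ext φ fun p => ?_
  rw [push_perm, push_perm, nat_map]

/-- Together with `Respects.act` this shows that compatibility with a natural transformation passes
from generators to all operations. -/
theorem Respects.comp {η : A ⟶ B} {c d : SMon C} {x : C} (i : Fin c.len) {α : Op A c x}
    {β : Op B c x} {α' : Op A d (c.col i)} {β' : Op B d (c.col i)} (h : Respects η α β)
    (h' : Respects η α' β') : Respects η (compHom i α α') (compHom i β β') := fun v => by
  rw [compHom_apply, compHom_apply, h]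
  congr 1
  funext j
  by_cases hj : j = i
  · subst hj
    rw [fill_same, fill_same, h']
    congr 1
    funext l
    exact nat_tr η _ _
  · rw [fill_ne _ _ _ _ hj, fill_ne _ _ _ _ hj]
    exact nat_tr η _ _

end EndOp

end CatOperad

namespace CatOperad

open SMon COperad.Hom

variable {k : Type u} [Field k] {C : Type u} [SmallCategory C]

/-! ### Universal property of the hyperoperad -/

/-- The class of the symbol `s` with morphisms of bouquets attached to its inputs and its output is
the result of the actions on the class of `s`. -/
theorem freeGen_symbElt (s : Symb C) {a : Fin 2 → Bq C} {b : Bq C} (Φ : a ⟶ s.source)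
    (Ω : s.target ⟶ b) :
    freeGen (hyperGen k C) (n := 2) (c := a) (x := b)
        (Submodule.Quotient.mk (p := relSubmodule (symbColl k C) _ _) (symbElt k s Φ Ω)) =
      (freeOperad (hyperGen k C)).coll.act (ofPi Φ) Ω (star k s.c s.x s.i s.d s.y s.f) := by
  -- The generators are included naturally, so acting on the class of a symbol in the free operad is
  -- the same as acting in `Q`, where the action composes the attached morphisms.
  refine Eq.trans ?_ (Quotient.sound (FreeTerm.Rel.gen_natural (X := hyperGen k C) (n := 2) Φ Ω
    (Submodule.Quotient.mk (p := relSubmodule (symbColl k C) _ _) (symbElt k s (𝟙 _) (𝟙 _)))))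
  refine congrArg (fun z => freeGen (hyperGen k C) (n := 2) (c := a) (x := b)
    (Submodule.Quotient.mk (p := relSubmodule (symbColl k C) _ _) z)) ?_
  refine Eq.symm ((Finsupp.mapDomain_single ..).trans ?_)
  exact congrArg (fun f => Finsupp.single (⟨s, f⟩ : SymbAt C (op a, b)) (1 : k))
    (Prod.ext (Category.id_comp _) (Category.id_comp _))

/-- By `freeGen_symbElt` both sides are classes of basis elements, and their difference is one of
the relations divided out in `Q`. -/
theorem star_equivariant {c c' d d' : SMon C} {x x' y y' : C} (φ : c ⟶ c') (u : x' ⟶ x)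
    (i : Fin c.len) (ψ : d ⟶ d') (v : y' ⟶ y) (h : y ⟶ c.col i) :
    (freeOperad (hyperGen k C)).coll.act
        (ofPi (pairHom (a := (op c', x')) (a' := (op c, x)) (b := (op d', y')) (b' := (op d, y))
          (φ.op, u) (ψ.op, v))) (𝟙 (op (c.subst i d), x)) (star k c x i d y h) =
      (freeOperad (hyperGen k C)).coll.act (𝟙 _) (Prod.mkHom (insert φ i ψ).op u)
        (star k c' x' (perm φ i) d' y' (v ≫ h ≫ app φ i)) := by
  refine (freeGen_symbElt ⟨c, x, i, d, y, h⟩ _ _).symm.trans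
    (Eq.trans ?_ (freeGen_symbElt ⟨c', x', perm φ i, d', y', v ≫ h ≫ app φ i⟩ _ _))
  refine congrArg (freeGen (hyperGen k C) (n := 2)) ((Submodule.Quotient.eq _).2 ?_)
  exact Submodule.subset_span ⟨_, 𝟙 _, _, EquivariantRel.mk φ u i ψ v h,
    LinearMap.congr_fun (congrArg ModuleCat.Hom.hom ((symbColl k C).map_id _)) _⟩

variable (k C) in
/-- The projection from the free operad to the hyperoperad. -/
noncomputable def hyperMk : freeOperad (hyperGen k C) ⟶ hyperoperad k C :=
  COperad.quotMk _ _

variable (k) in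
/-- The class of the symbol `*ᵢᶠ` in the hyperoperad. -/
noncomputable def hyperStar (c : SMon C) (x : C) (i : Fin c.len) (d : SMon C) (y : C)
    (f : y ⟶ c.col i) : (hyperoperad k C).val ⟨2, ![(op c, x), (op d, y)]⟩
      (op (c.subst i d), x) :=
  lin (hyperMk k C) _ _ (star k c x i d y f)

theorem lin_compOne {D : Type u} [SmallCategory D] {P E : COperad k D} (φ : P ⟶ E)
    {a b e p x : D} (s : P.val ⟨2, ![p, e]⟩ x) (t : P.val ⟨2, ![a, b]⟩ p) :
    lin φ _ _ (compOne k P s t) = compOne k E (lin φ _ _ s) (lin φ _ _ t) :=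
  (lin_cast ..).trans (congrArg _ (lin_comp ..))

theorem lin_compTwo {D : Type u} [SmallCategory D] {P E : COperad k D} (φ : P ⟶ E)
    {a b e p x : D} (s : P.val ⟨2, ![a, p]⟩ x) (t : P.val ⟨2, ![b, e]⟩ p) :
    lin φ _ _ (compTwo k P s t) = compTwo k E (lin φ _ _ s) (lin φ _ _ t) :=
  (lin_cast ..).trans (congrArg _ (lin_comp ..))

theorem lin_swapInputs {D : Type u} [SmallCategory D] {P E : COperad k D} (φ : P ⟶ E)
    {a b e x : D} (s : P.val ⟨3, ![a, e, b]⟩ x) :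
    lin φ _ _ (swapInputs k P s) = swapInputs k E (lin φ _ _ s) :=
  (lin_cast ..).trans (congrArg _ (lin_act ..))

/-- Values for the symbols `*ᵢᶠ` in an operad which satisfy `C`-equivariance and
`C`-associativity. -/
structure HyperData (E : COperad k (Bq C)) where
  star : ∀ (c : SMon C) (x : C) (i : Fin c.len) (d : SMon C) (y : C) (_ : y ⟶ c.col i),
    E.val ⟨2, ![(op c, x), (op d, y)]⟩ (op (c.subst i d), x)
  equivariant : ∀ {c c' d d' : SMon C} {x x' y y' : C} (φ : c ⟶ c') (u : x' ⟶ x)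
    (i : Fin c.len) (ψ : d ⟶ d') (v : y' ⟶ y) (h : y ⟶ c.col i),
    E.coll.act
        (ofPi (pairHom (a := (op c', x')) (a' := (op c, x)) (b := (op d', y')) (b' := (op d, y))
          (φ.op, u) (ψ.op, v))) (𝟙 (op (c.subst i d), x)) (star c x i d y h) =
      E.coll.act (𝟙 _) (Prod.mkHom (insert φ i ψ).op u)
        (star c' x' (perm φ i) d' y' (v ≫ h ≫ app φ i))
  seq : ∀ (c : SMon C) (x : C) (i : Fin c.len) (d : SMon C) (y : C) (l : Fin d.len) (e : SMon C)
      (z : C) (f : y ⟶ c.col i) (g : z ⟶ d.col l),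
    compOne k E (star (c.subst i d) x (inPos c i d l) e z (g ≫ eqToHom (subst_inPos c i d l).symm))
        (star c x i d y f) =
      E.coll.cast rfl (congrArg (fun s => ((op s, x) : Bq C)) (subst_seq c i d l e).symm)
        (compTwo k E (star c x i (d.subst l e) y f) (star d y l e z g))
  par : ∀ (c : SMon C) (x : C) (i j : Fin c.len) (h : i ≠ j) (d : SMon C) (y : C) (e : SMon C)
      (z : C) (f : y ⟶ c.col j) (g : z ⟶ c.col i),
    compOne k E (star (c.subst j d) x (outPos c j d i h) e z
          (g ≫ eqToHom (subst_outPos c j d i h).symm)) (star c x j d y f) =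
      E.coll.cast rfl (congrArg (fun s => ((op s, x) : Bq C)) (subst_par c i j h d e).symm)
        (swapInputs k E (compOne k E (star (c.subst i e) x (outPos c i e j h.symm) d y
          (f ≫ eqToHom (subst_outPos c i e j h.symm).symm)) (star c x i e z g)))

/-- The values of the symbols under a morphism out of the hyperoperad. -/
noncomputable def HyperData.ofHom {E : COperad k (Bq C)} (ϕ : hyperoperad k C ⟶ E) :
    HyperData E where
  star c x i d y f := lin ϕ _ _ (hyperStar k c x i d y f)
  equivariant φ u i ψ v h := by
    have := congrArg (fun a => lin ϕ _ _ (lin (hyperMk k C) _ _ a))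
      (star_equivariant (k := k) φ u i ψ v h)
    simp only [lin_act] at this
    exact this
  seq c x i d y l e z f g := by
    -- The associator dies in the quotient; its image under the composite `hyperMk k C ≫ ϕ` is the
    -- required identity, as morphisms of operads commute with composition and transport.
    have h := COperad.quotMk_eq_zero_of_mem (freeOperad (hyperGen k C))
      (A := fun b z => {a | AssociativeRel k b z a}) (AssociativeRel.seq c x i d y l e z f g)
    rw [map_sub, sub_eq_zero] at h
    exact (lin_compOne (hyperMk k C ≫ ϕ) _ _).symm.trans ((congrArg (lin ϕ _ _) h).trans
      ((lin_cast (hyperMk k C ≫ ϕ) ..).trans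
        (congrArg _ (lin_compTwo (hyperMk k C ≫ ϕ) _ _))))
  par c x i j hij d y e z f g := by
    have h := COperad.quotMk_eq_zero_of_mem (freeOperad (hyperGen k C))
      (A := fun b z => {a | AssociativeRel k b z a}) (AssociativeRel.par c x i j hij d y e z f g)
    rw [map_sub, sub_eq_zero] at h
    exact (lin_compOne (hyperMk k C ≫ ϕ) _ _).symm.trans ((congrArg (lin ϕ _ _) h).trans
      ((lin_cast (hyperMk k C ≫ ϕ) ..).trans
        (congrArg _ ((lin_swapInputs (hyperMk k C ≫ ϕ) _).trans
          (congrArg _ (lin_compOne (hyperMk k C ≫ ϕ) _ _))))))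

/-! ### The morphism out of `ℍ_C` given by values on the symbols -/

namespace HyperData

variable {E : COperad k (Bq C)} (S : HyperData E)

/-- The map on the free collection on the symbols. -/
noncomputable def symbLift (Z : (Fin 2 → Bq C)ᵒᵖ × Bq C) :
    (symbColl k C).obj Z →ₗ[k] E.val ⟨2, Z.1.unop⟩ Z.2 :=
  Finsupp.linearCombination k fun a : SymbAt C Z =>
    E.coll.act (ofPi a.2.1.unop) a.2.2 (S.star a.1.c a.1.x a.1.i a.1.d a.1.y a.1.f)

theorem symbLift_symbElt (s : Symb C) {a : Fin 2 → Bq C} {b : Bq C} (Φ : a ⟶ s.source)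
    (Ω : s.target ⟶ b) : S.symbLift (op a, b) (symbElt k s Φ Ω) =
      E.coll.act (ofPi Φ) Ω (S.star s.c s.x s.i s.d s.y s.f) :=
  (Finsupp.linearCombination_single ..).trans (one_smul k _)

theorem symbLift_map {Z W : (Fin 2 → Bq C)ᵒᵖ × Bq C} (f : Z ⟶ W) (a : (symbColl k C).obj Z) :
    S.symbLift W (((symbColl k C).map f).hom a) =
      E.coll.act (ofPi f.1.unop) f.2 (S.symbLift Z a) := by
  have h : S.symbLift W ∘ₗ ((symbColl k C).map f).hom =
      E.coll.act (ofPi f.1.unop) f.2 ∘ₗ S.symbLift Z := by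
    refine Finsupp.lhom_ext' fun a => LinearMap.ext_ring ?_
    change Finsupp.linearCombination k _ (Finsupp.mapDomain _ (Finsupp.single a 1)) =
      E.coll.act _ _ (Finsupp.linearCombination k _ (Finsupp.single a 1))
    rw [Finsupp.mapDomain_single, Finsupp.linearCombination_single,
      Finsupp.linearCombination_single, one_smul, one_smul]
    exact (E.coll.act_act (ofPi f.1.unop) (ofPi a.2.1.unop) a.2.2 f.2 _).symm
  exact LinearMap.congr_fun h a

/-- The subfunctor is spanned by translates of equivariance relations. By `symbLift_map` a translate
may be pulled out, and on the relation itself the claim is the equivariance of `S`. -/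
theorem symbLift_eq_zero (Z : (Fin 2 → Bq C)ᵒᵖ × Bq C) :
    relSubmodule (symbColl k C) (fun Z => {a | EquivariantRel k Z a}) Z ≤
      LinearMap.ker (S.symbLift Z) := by
  refine Submodule.span_le.2 ?_
  rintro _ ⟨W, f, r, hr, rfl⟩
  refine LinearMap.mem_ker.2 ((S.symbLift_map f r).trans ?_)
  obtain @⟨c, c', d, d', x, x', y, y', φ, u, i, ψ, v, h⟩ := hr
  refine (congrArg _ ((map_sub ..).trans (sub_eq_zero.2 ?_))).trans (map_zero _)
  exact (S.symbLift_symbElt ..).trans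
    ((S.equivariant φ u i ψ v h).trans
      (S.symbLift_symbElt ⟨c', x', perm φ i, d', y', v ≫ h ≫ app φ i⟩ (𝟙 _) _).symm)

/-- The map on the generators of the hyperoperad. -/
noncomputable def genLift : ∀ (n : ℕ) (c : Fin n → Bq C) (x : Bq C),
    (hyperGen k C n).obj (op c, x) →ₗ[k] E.val ⟨n, c⟩ x
  | 2, c, x => Submodule.liftQ _ (S.symbLift (op c, x)) (S.symbLift_eq_zero (op c, x))
  -- Outside arity `2` the generators form the zero space.
  | 0, _, _ => 0
  | 1, _, _ => 0
  | _ + 3, _, _ => 0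

theorem genLift_natural : ∀ {n : ℕ} {c c' : Fin n → Bq C} {x x' : Bq C} (f : c ⟶ c') (u : x ⟶ x')
    (a : (hyperGen k C n).obj (op c', x)), S.genLift n c x'
      (((hyperGen k C n).map (X := (op c', x)) (Y := (op c, x')) (f.op, u)).hom a) =
        E.coll.act (ofPi f) u (S.genLift n c' x a)
  | 2, c, c', x, x', f, u, a => by
    obtain ⟨a, rfl⟩ := Submodule.Quotient.mk_surjective _ a
    exact S.symbLift_map (Z := (op c', x)) (W := (op c, x')) (f.op, u) a
  | 0, _, _, _, _, _, _, _ => (map_zero _).symm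
  | 1, _, _, _, _, _, _, _ => (map_zero _).symm
  | _ + 3, _, _, _, _, _, _, _ => (map_zero _).symm

/-- The morphism out of the free operad with given values on the symbols. -/
noncomputable def freeHom : freeOperad (hyperGen k C) ⟶ E :=
  freeLift E S.genLift S.genLift_natural

theorem freeHom_star (c : SMon C) (x : C) (i : Fin c.len) (d : SMon C) (y : C)
    (f : y ⟶ c.col i) : lin S.freeHom _ _ (CatOperad.star k c x i d y f) = S.star c x i d y f :=
  (S.symbLift_symbElt ⟨c, x, i, d, y, f⟩ _ _).trans (Coll.act_id _ _)

/-- The morphism out of the hyperoperad with given values on the symbols. -/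
noncomputable def hom : hyperoperad k C ⟶ E :=
  liftSpan S.freeHom (fun b z => {a | AssociativeRel k b z a}) (by
    rintro _ _ _ (⟨c, x, i, d, y, l, e, z, f, g⟩ | ⟨c, x, i, j, h, d, y, e, z, f, g⟩)
    · rw [map_sub, sub_eq_zero, lin_cast, lin_compOne, lin_compTwo]
      simp only [freeHom_star]
      exact S.seq c x i d y l e z f g
    · rw [map_sub, sub_eq_zero, lin_cast, lin_swapInputs, lin_compOne, lin_compOne]
      simp only [freeHom_star]
      exact S.par c x i j h d y e z f g)

theorem hom_star (c : SMon C) (x : C) (i : Fin c.len) (d : SMon C) (y : C)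
    (f : y ⟶ c.col i) : lin S.hom _ _ (hyperStar k c x i d y f) = S.star c x i d y f :=
  S.freeHom_star c x i d y f

end HyperData

/-! ### Generation by the symbols, and binary quadraticity -/

theorem hyperGen_subsingleton : ∀ (n : ℕ), n ≠ 2 → ∀ Z, Subsingleton ((hyperGen k C n).obj Z)
  | 0, _, _ => inferInstanceAs (Subsingleton PUnit)
  | 1, _, _ => inferInstanceAs (Subsingleton PUnit)
  | 2, h, _ => absurd rfl h
  | _ + 3, _, _ => inferInstanceAs (Subsingleton PUnit)

/-- Induction over the hyperoperad. -/
theorem hyper_induction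
    {motive : ∀ (c : SMon (Bq C)) (x : Bq C), (hyperoperad k C).val c x → Prop}
    (star : ∀ (c : SMon C) (x : C) (i : Fin c.len) (d : SMon C) (y : C) (f : y ⟶ c.col i),
      motive _ _ (hyperStar k c x i d y f))
    (act : ∀ {c c' : SMon (Bq C)} {x x' : Bq C} (φ : c ⟶ c') (u : x ⟶ x')
      (a : (hyperoperad k C).val c' x), motive _ _ a →
        motive _ _ ((hyperoperad k C).coll.act φ u a))
    (comp : ∀ {c d : SMon (Bq C)} {x : Bq C} (i : Fin c.len) (a : (hyperoperad k C).val c x)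
      (b : (hyperoperad k C).val d (c.col i)), motive _ _ a → motive _ _ b →
        motive _ _ ((hyperoperad k C).comp i a b))
    (zero : ∀ c x, motive c x 0)
    (add : ∀ {c x} (a b : (hyperoperad k C).val c x), motive _ _ a → motive _ _ b →
      motive _ _ (a + b))
    (smul : ∀ {c x} (r : k) (a : (hyperoperad k C).val c x), motive _ _ a → motive _ _ (r • a))
    {c : SMon (Bq C)} {x : Bq C} (a : (hyperoperad k C).val c x) : motive c x a := by
  obtain ⟨a, rfl⟩ := Submodule.Quotient.mk_surjective _ a
  refine free_induction (motive := fun c x a => motive c x (lin (hyperMk k C) c x a))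
    ?_ (fun φ u a h => act φ u _ h) (fun i a b h h' => comp i _ _ h h') (fun c x => zero c x)
    (fun a b h h' => add _ _ h h') (fun r a h => smul r _ h) a
  intro n c x a
  by_cases hn : n = 2
  · subst hn
    obtain ⟨a, rfl⟩ := Submodule.Quotient.mk_surjective _ a
    -- Linearity of `L` reduces a binary generator to basis elements `(*ᵢᶠ, Φ₁ Φ₂; Ω)`, which are
    -- obtained from symbols by the actions.
    let L : (symbColl k C).obj (op c, x) →ₗ[k] (hyperoperad k C).val ⟨2, c⟩ x :=
      lin (hyperMk k C) _ _ ∘ₗ freeGen (hyperGen k C) (n := 2) ∘ₗ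
        Submodule.mkQ (relSubmodule (symbColl k C) _ _)
    refine Finsupp.induction_linear
      (motive := fun a : SymbAt C (op c, x) →₀ k => motive _ _ (L a)) a ?_ ?_ ?_
    · exact (map_zero L).symm ▸ zero _ _
    · exact fun f g hf hg => (map_add L f g).symm ▸ add _ _ hf hg
    · rintro ⟨s, f⟩ r
      have h : Finsupp.single (⟨s, f⟩ : SymbAt C (op c, x)) r = r • symbElt k s f.1.unop f.2 :=
        (Finsupp.smul_single_one _ r).symm
      rw [h]
      refine (map_smul L r (symbElt k s f.1.unop f.2)).symm ▸ smul r _ ?_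
      have h' := congrArg (lin (hyperMk k C) _ _) (freeGen_symbElt (k := k) s f.1.unop f.2)
      exact (h'.trans (lin_act ..)).symm ▸ act _ _ _ (star ..)
  · have := hyperGen_subsingleton (k := k) (C := C) n hn (op c, x)
    rw [Subsingleton.elim a 0, map_zero]
    exact zero _ _

/-- A morphism out of the hyperoperad is determined by its values on the symbols. -/
theorem hyper_hom_ext {E : COperad k (Bq C)} {ϕ ψ : hyperoperad k C ⟶ E}
    (h : ∀ (c : SMon C) (x : C) (i : Fin c.len) (d : SMon C) (y : C) (f : y ⟶ c.col i),
      lin ϕ _ _ (hyperStar k c x i d y f) = lin ψ _ _ (hyperStar k c x i d y f)) : ϕ = ψ := by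
  refine ext_lin fun c x a => hyper_induction
    (motive := fun c x a => lin ϕ c x a = lin ψ c x a) h ?_ ?_ ?_ ?_ ?_ a
  · intro c c' x x' φ u a h
    rw [lin_act, lin_act, h]
  · intro c d x i a b h h'
    rw [lin_comp, lin_comp, h, h']
  · intro c x
    rw [map_zero, map_zero]
  · intro c x a b h h'
    rw [map_add, map_add, h, h']
  · intro c x r a h
    rw [map_smul, map_smul, h]

variable (k C) in
theorem hyperoperad_isBinaryQuadratic : (hyperoperad k C).IsBinaryQuadratic := by
  -- The hyperoperad is by definition the required quotient, so only the weights of the relations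
  -- need an argument.
  refine ⟨hyperGen k C, _, hyperGen_subsingleton, ?_, ⟨Iso.refl _⟩⟩
  have hs (c : SMon C) (x : C) (i : Fin c.len) (d : SMon C) (y : C) (f : y ⟶ c.col i) :
      HasWeight (hyperGen k C) 1 _ _ (star k c x i d y f) := HasWeight.gen (X := hyperGen k C) _
  have hsub {c : SMon (Bq C)} {x : Bq C} {a b : (freeOperad (hyperGen k C)).val c x}
      (ha : HasWeight (hyperGen k C) 2 c x a) (hb : HasWeight (hyperGen k C) 2 c x b) :
      HasWeight (hyperGen k C) 2 c x (a - b) := by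
    rw [sub_eq_add_neg, ← neg_one_smul k b]
    exact ha.add (hb.smul _)
  rintro _ _ _ (⟨c, x, i, d, y, l, e, z, f, g⟩ | ⟨c, x, i, j, h, d, y, e, z, f, g⟩)
  -- Transports and the swap of inputs are actions of morphisms, which preserve weight; each term
  -- contains a single composition of two symbols.
  · exact hsub (.act _ _ (.comp (v := 1) (w := 1) _ (hs ..) (hs ..)))
      (.act _ _ (.act _ _ (.comp (v := 1) (w := 1) _ (hs ..) (hs ..))))
  · exact hsub (.act _ _ (.comp (v := 1) (w := 1) _ (hs ..) (hs ..)))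
      (.act _ _ (.act _ _ (.act _ _ (.act _ _ (.comp (v := 1) (w := 1) _ (hs ..) (hs ..))))))

end CatOperad

namespace CatOperad

open SMon COperad.Hom EndOp

variable {k : Type u} [Field k] {C : Type u} [SmallCategory C]

/-! ### Operads as algebras of the hyperoperad -/

namespace Coll

/-- Transport in a collection along an equality of lists of inputs. -/
theorem tr_eq_cast (A : Coll k C) {s s' : SMon C} (h : s = s') {x : C} (a : A.val s x) :
    EndOp.tr A (congrArg (fun s => ((op s, x) : Bq C)) h) a = A.cast h rfl a := by
  subst h
  exact (tr_rfl A a).trans (A.act_id a).symm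

end Coll

/-! ### From operads to algebras of the hyperoperad -/

namespace COperad

variable (P : COperad k C)

/-- The operation `*ᵢᶠ` on the spaces of an operad. -/
def starOp (c : SMon C) (x : C) (i : Fin c.len) (d : SMon C) (y : C) (f : y ⟶ c.col i) :
    Op P.coll ⟨2, ![(op c, x), (op d, y)]⟩ (op (c.subst i d), x) :=
  ofBilin (a := (op c, x)) (b := (op d, y)) ((P.comp i).compl₂ (P.coll.act (𝟙 d) f))

theorem starOp_pair (c : SMon C) (x : C) (i : Fin c.len) (d : SMon C) (y : C) (f : y ⟶ c.col i)
    (α : P.val c x) (β : P.val d y) :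
    P.starOp c x i d y f (pair (A := P.coll) (a := (op c, x)) (b := (op d, y)) α β) =
      P.comp i α (P.coll.act (𝟙 d) f β) := rfl

/-- Sequential associativity with connecting morphisms: `f` acts on the output of `β`, hence slides
past `∘ₗ` to the output of the composite of `β` with `γ`. -/
theorem comp_act_seq {c d e : SMon C} {x y z : C} (i : Fin c.len) (l : Fin d.len)
    (f : y ⟶ c.col i) (g : z ⟶ d.col l) (α : P.val c x) (β : P.val d y) (γ : P.val e z) :
    P.comp (inPos c i d l) (P.comp i α (P.coll.act (𝟙 d) f β))
        (P.coll.act (𝟙 e) (g ≫ eqToHom (subst_inPos c i d l).symm) γ) =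
      P.coll.cast (subst_seq c i d l e).symm rfl
        (P.comp i α (P.coll.act (𝟙 _) f (P.comp l β (P.coll.act (𝟙 e) g γ)))) := by
  have h := P.comp_seq i l α (P.coll.act (𝟙 d) f β) (P.coll.act (𝟙 e) g γ)
  have h₁ : P.comp l (P.coll.act (𝟙 d) f β) (P.coll.act (𝟙 e) g γ) =
      P.coll.act (𝟙 _) f (P.comp l β (P.coll.act (𝟙 e) g γ)) := by
    have := P.comp_act (𝟙 d) f l (𝟙 e) g β γ
    rw [insert_id] at this
    refine this.trans ?_
    exact congrArg (fun g => P.coll.act (𝟙 _) f (P.comp l β (P.coll.act (𝟙 e) g γ)))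
      (Category.comp_id g)
  rw [h₁] at h
  refine Eq.trans (congrArg _ ?_) h
  exact (congrArg (fun φ => P.coll.act φ _ γ) (Category.id_comp (𝟙 e)).symm).trans
    (P.coll.act_act _ _ _ _ _).symm

theorem comp_act_par {c d e : SMon C} {x y z : C} (i j : Fin c.len) (h : i ≠ j)
    (f : y ⟶ c.col j) (g : z ⟶ c.col i) (α : P.val c x) (β : P.val d y) (γ : P.val e z) :
    P.comp (outPos c j d i h) (P.comp j α (P.coll.act (𝟙 d) f β))
        (P.coll.act (𝟙 e) (g ≫ eqToHom (subst_outPos c j d i h).symm) γ) =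
      P.coll.cast (subst_par c i j h d e).symm rfl
        (P.comp (outPos c i e j h.symm) (P.comp i α (P.coll.act (𝟙 e) g γ))
          (P.coll.act (𝟙 d) (f ≫ eqToHom (subst_outPos c i e j h.symm).symm) β)) := by
  have h₀ {c : SMon C} {x y z : C} (f : x ⟶ y) (e : y = z) (β : P.val c x) :
      P.coll.act (𝟙 c) (f ≫ eqToHom e) β = P.coll.cast rfl e (P.coll.act (𝟙 c) f β) :=
    (congrArg (fun φ => P.coll.act φ _ β) (Category.id_comp (𝟙 c)).symm).trans
      (P.coll.act_act _ _ _ _ _).symm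
  rw [h₀, h₀]
  exact P.comp_par i j h α (P.coll.act (𝟙 d) f β) (P.coll.act (𝟙 e) g γ)

/-- The operations `*ᵢᶠ` of an operad satisfy the relations of the hyperoperad. -/
def hyperData : HyperData (endOperad P.coll) where
  star := P.starOp
  equivariant {c c' d d' x x' y y'} φ u i ψ v h := by
    refine MultilinearMap.ext fun w => ?_
    obtain ⟨α, β, rfl⟩ : ∃ α β, pair (a := (op c', x')) (b := (op d', y')) α β = w :=
      ⟨_, _, pair_eta w⟩
    have e₁ : push (ofPi (pairHom (a := (op c', x')) (a' := (op c, x)) (b := (op d', y'))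
        (b' := (op d, y)) (φ.op, u) (ψ.op, v))) (pair (A := P.coll) α β) =
        pair (A := P.coll) (a := (op c, x)) (b := (op d, y)) (P.coll.act φ u α)
          (P.coll.act ψ v β) := by
      funext j
      refine (push_ofPi _ _ j).trans ?_
      change Fin 2 at j
      fin_cases j <;> rfl
    change (P.coll.map (𝟙 _)).hom (P.starOp c x i d y h (push (ofPi (pairHom _ _)) _)) =
      P.coll.act (insert φ i ψ) u (P.starOp c' x' (perm φ i) d' y' _ (push (𝟙 _) _))
    rw [push_id, e₁, starOp_pair, starOp_pair]
    refine (P.coll.act_id _).trans ?_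
    -- The two connecting morphisms combine to `v ≫ h`, and `comp_act` appends `app φ i`; this is
    -- the composite `fᵢ h v` of the equivariance relation.
    rw [Coll.act_act, Category.id_comp, P.comp_act, Category.assoc]
  seq c x i d y l e z f g := by
    refine MultilinearMap.ext fun w => ?_
    obtain ⟨α, β, γ, rfl⟩ : ∃ α β γ, triple (a := (op c, x)) (b := (op d, y))
      (e := (op e, z)) α β γ = w := ⟨_, _, _, triple_eta w⟩
    refine (compOne_apply (P.starOp ..) (P.starOp ..) α β γ).trans ?_
    refine (P.comp_act_seq i l f g α β γ).trans ?_
    refine Eq.trans ?_ (Coll.tr_eq_cast P.coll (subst_seq c i d l e).symm _).symm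
    -- The transport changes only the output bouquet; on the inputs it is the identity.
    refine congrArg _ (Eq.trans ?_ (congrArg _ (push_id _)).symm)
    exact (compTwo_apply (P.starOp ..) (P.starOp ..) α β γ).symm
  par c x i j h d y e z f g := by
    refine MultilinearMap.ext fun w => ?_
    obtain ⟨α, β, γ, rfl⟩ : ∃ α β γ, triple (a := (op c, x)) (b := (op d, y))
      (e := (op e, z)) α β γ = w := ⟨_, _, _, triple_eta w⟩
    refine (compOne_apply (P.starOp ..) (P.starOp ..) α β γ).trans ?_
    refine (P.comp_act_par i j h f g α β γ).trans ?_
    refine Eq.trans ?_ (Coll.tr_eq_cast P.coll (subst_par c i j h d e).symm _).symm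
    refine congrArg _ (Eq.trans ?_ (congrArg _ (push_id _)).symm)
    refine Eq.trans ?_ (swapInputs_apply _ α β γ).symm
    exact (compOne_apply (P.starOp ..) (P.starOp ..) α γ β).symm

/-- The algebra of the hyperoperad associated with an operad. -/
noncomputable def toAlg : Alg (hyperoperad k C) where
  obj := P.coll
  str := P.hyperData.hom

theorem lin_toAlg (c : SMon C) (x : C) (i : Fin c.len) (d : SMon C) (y : C) (f : y ⟶ c.col i) :
    lin P.toAlg.str _ _ (hyperStar k c x i d y f) = P.starOp c x i d y f :=
  P.hyperData.hom_star c x i d y f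

end COperad

/-! ### From algebras of the hyperoperad to operads -/

namespace Alg

variable (M : Alg (hyperoperad k C))

/-- The operation of an algebra given by the symbol `*ᵢᶠ`. -/
noncomputable def starOp (c : SMon C) (x : C) (i : Fin c.len) (d : SMon C) (y : C)
    (f : y ⟶ c.col i) : Op M.obj ⟨2, ![(op c, x), (op d, y)]⟩ (op (c.subst i d), x) :=
  lin M.str _ _ (hyperStar k c x i d y f)

/-- The operation of an algebra given by the symbol `*ᵢᶠ`, as a bilinear map. -/
noncomputable def starMap {c : SMon C} {x : C} (i : Fin c.len) {d : SMon C} {y : C}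
    (f : y ⟶ c.col i) : Coll.val M.obj c x →ₗ[k] Coll.val M.obj d y →ₗ[k]
      Coll.val M.obj (c.subst i d) x :=
  toBilin (a := (op c, x)) (b := (op d, y)) (M.starOp c x i d y f)

/-- The equivariance relation of the hyperoperad, evaluated on the pair `(α, β)`. -/
theorem starMap_act {c c' d d' : SMon C} {x x' y y' : C} (φ : c ⟶ c') (u : x' ⟶ x)
    (i : Fin c.len) (ψ : d ⟶ d') (v : y' ⟶ y) (h : y ⟶ c.col i) (α : Coll.val M.obj c' x')
    (β : Coll.val M.obj d' y') :
    M.starMap i h (Coll.act M.obj φ u α) (Coll.act M.obj ψ v β) =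
      Coll.act M.obj (insert φ i ψ) u (M.starMap (perm φ i) (v ≫ h ≫ app φ i) α β) := by
  have e := (HyperData.ofHom M.str).equivariant φ u i ψ v h
  have e := DFunLike.congr_fun (F := Op M.obj _ _) e
    (pair (a := (op c', x')) (b := (op d', y')) α β)
  have e₁ : push (ofPi (pairHom (a := (op c', x')) (a' := (op c, x)) (b := (op d', y'))
      (b' := (op d, y)) (φ.op, u) (ψ.op, v))) (pair (A := M.obj) α β) =
      pair (A := M.obj) (a := (op c, x)) (b := (op d, y)) (Coll.act M.obj φ u α)
        (Coll.act M.obj ψ v β) := by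
    funext j
    refine (push_ofPi _ _ j).trans ?_
    change Fin 2 at j
    fin_cases j <;> rfl
  change (M.obj.map (𝟙 _)).hom (M.starOp c x i d y h (push (ofPi (pairHom _ _)) _)) =
    Coll.act M.obj (insert φ i ψ) u (M.starOp c' x' (perm φ i) d' y' _ (push (𝟙 _) _)) at e
  rw [push_id, e₁] at e
  exact (Coll.act_id M.obj _).symm.trans e

/-- Equivariance with identities everywhere except for `f` at the output of the second bouquet. Thus
the operations `*ᵢ¹` determine all `*ᵢᶠ`. -/
theorem starMap_eq {c d : SMon C} {x y : C} (i : Fin c.len) (f : y ⟶ c.col i)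
    (α : Coll.val M.obj c x) (β : Coll.val M.obj d y) :
    M.starMap i f α β = M.starMap i (𝟙 _) α (Coll.act M.obj (𝟙 d) f β) := by
  have h := M.starMap_act (𝟙 c) (𝟙 x) i (𝟙 d) f (𝟙 _) α β
  rw [insert_id, Coll.act_id] at h
  refine Eq.trans ?_ (h.trans (Coll.act_id M.obj _)).symm
  refine congrArg (fun f => M.starMap i f α β) ?_
  exact ((congrArg (f ≫ ·) (Category.id_comp (𝟙 _))).trans (Category.comp_id f)).symm

/-- Equivariance moves the component of `φ` at the slot into the label of the symbol, and
`starMap_eq` turns the label into an action on `β`. For `φ = (1, f₁ … fₙ)` this is naturality with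
the cowedge condition; for `φ = (σ, 1 … 1)` that component is an identity. -/
theorem starMap_comp_act {c c' d d' : SMon C} {x x' : C} (φ : c ⟶ c') (u : x ⟶ x')
    (i : Fin c.len) (ψ : d ⟶ d') (α : Coll.val M.obj c' x) (β : Coll.val M.obj d' (c.col i)) :
    M.starMap i (𝟙 _) (Coll.act M.obj φ u α) (Coll.act M.obj ψ (𝟙 _) β) =
      Coll.act M.obj (insert φ i ψ) u
        (M.starMap (perm φ i) (𝟙 _) α (Coll.act M.obj (𝟙 _) (app φ i) β)) := by
  refine (M.starMap_act φ u i ψ (𝟙 _) (𝟙 _) α β).trans ?_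
  rw [Category.id_comp, Category.id_comp, M.starMap_eq]

/-- The operad associated with an algebra of the hyperoperad. -/
noncomputable def toCOperad : COperad k C where
  coll := M.obj
  comp i := M.starMap i (𝟙 _)
  comp_natural f u i g α β := M.starMap_comp_act (ofPi f) u i (ofPi g) α β
  comp_equivariant {n m c d x} σ i τ α β :=
    (M.starMap_comp_act (ofPerm σ c) (𝟙 x) i (ofPerm τ d) α β).trans
      (congrArg (fun β => Coll.act M.obj (insert (ofPerm σ c) i (ofPerm τ d)) (𝟙 x)
        (M.starMap (c := ⟨n, c⟩) (d := ⟨m, d⟩) (σ i) (𝟙 _) α β)) (Coll.act_id M.obj β))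
  comp_seq {c d e x} i l α β γ := by
    have h := (HyperData.ofHom M.str).seq c x i d (c.col i) l e (d.col l) (𝟙 _) (𝟙 _)
    have h := DFunLike.congr_fun (F := Op M.obj _ _) h
      (triple (a := (op c, x)) (b := (op d, c.col i)) (e := (op e, d.col l)) α β γ)
    have h₁ := compOne_apply (M.starOp (c.subst i d) x (inPos c i d l) e (d.col l)
      (𝟙 _ ≫ eqToHom (subst_inPos c i d l).symm)) (M.starOp c x i d (c.col i) (𝟙 _)) α β γ
    have h₂ := compTwo_apply (M.starOp c x i (d.subst l e) (c.col i) (𝟙 _))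
      (M.starOp d (c.col i) l e (d.col l) (𝟙 _)) α β γ
    refine Eq.trans ?_ ((h₁.symm.trans h).trans ((Coll.tr_eq_cast ..).trans
      (congrArg _ ((congrArg _ (push_id _)).trans h₂))))
    -- In the operad axiom the change of colour acts on `γ`, in the associator it is part of the
    -- label of the symbol; `starMap_eq` exchanges the two.
    refine (M.starMap_eq _ (eqToHom _) _ γ).symm.trans ?_
    exact congrArg (fun f => M.starMap (inPos c i d l) f (M.starMap i (𝟙 _) α β) γ)
      (Category.id_comp _).symm
  comp_par {c d e x} i j hij α β γ := by
    have h := (HyperData.ofHom M.str).par c x i j hij d (c.col j) e (c.col i) (𝟙 _) (𝟙 _)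
    have h := DFunLike.congr_fun (F := Op M.obj _ _) h
      (triple (a := (op c, x)) (b := (op d, c.col j)) (e := (op e, c.col i)) α β γ)
    have h₁ := compOne_apply (M.starOp (c.subst j d) x (outPos c j d i hij) e (c.col i)
      (𝟙 _ ≫ eqToHom (subst_outPos c j d i hij).symm)) (M.starOp c x j d (c.col j) (𝟙 _)) α β γ
    have h₂ := compOne_apply (M.starOp (c.subst i e) x (outPos c i e j hij.symm) d (c.col j)
      (𝟙 _ ≫ eqToHom (subst_outPos c i e j hij.symm).symm)) (M.starOp c x i e (c.col i) (𝟙 _))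
      α γ β
    refine Eq.trans ?_ (((h₁.symm.trans h).trans ((Coll.tr_eq_cast ..).trans
      (congrArg _ ((congrArg _ (push_id _)).trans
        ((swapInputs_apply _ α β γ).trans h₂))))).trans (congrArg _ ?_))
    · refine (M.starMap_eq _ (eqToHom _) _ γ).symm.trans ?_
      exact congrArg (fun f => M.starMap (outPos c j d i hij) f (M.starMap j (𝟙 _) α β) γ)
        (Category.id_comp _).symm
    · refine Eq.trans ?_ (M.starMap_eq _ (eqToHom _) _ β)
      exact congrArg (fun f => M.starMap (outPos c i e j hij.symm) f (M.starMap i (𝟙 _) α γ) β)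
        (Category.id_comp _)

end Alg

/-! ### The isomorphism of categories -/

variable (k C)

/-- The functor from algebras of the hyperoperad to operads. -/
noncomputable def algToOperad : Alg (hyperoperad k C) ⥤ COperad k C where
  obj M := M.toCOperad
  map {M N} f :=
    { toNat := Alg.Hom.nat f
      map_comp := fun {c d x} i α β => by
        -- Preservation of `∘ᵢ` is compatibility with the single operation `*ᵢ¹`.
        refine (Alg.Hom.map_eval f (hyperStar k c x i d (c.col i) (𝟙 _))
          (pair (A := M.obj) (a := (op c, x)) (b := (op d, c.col i)) α β)).trans ?_
        refine congrArg (N.starOp c x i d (c.col i) (𝟙 _)) (funext fun j => ?_)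
        change Fin 2 at j
        fin_cases j <;> rfl }
  map_id _ := rfl
  map_comp _ _ := rfl

/-- The functor from operads to algebras of the hyperoperad. -/
noncomputable def operadToAlg : COperad k C ⥤ Alg (hyperoperad k C) where
  obj P := P.toAlg
  map {P Q} f :=
    { nat := COperad.Hom.toNat f
      -- On symbols, a morphism of operads preserves `∘ᵢ` and commutes with the action of the label;
      -- the remaining operations are generated by these.
      map_eval := fun p => hyper_induction
        (motive := fun c x p => Respects (COperad.Hom.toNat f) (A := P.coll) (B := Q.coll)
          (c := c) (x := x) (lin P.toAlg.str c x p) (lin Q.toAlg.str c x p))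
        (fun c x i d y g v => by
          rw [COperad.lin_toAlg, COperad.lin_toAlg]
          exact (COperad.Hom.map_comp f i _ _).trans (congrArg _ (lin_act f _ _ _)))
        (fun φ u a h => by
          rw [lin_act, lin_act]
          exact h.act φ u)
        (fun i a b h h' => by
          rw [lin_comp, lin_comp]
          exact h.comp i h')
        (fun c x v => by
          rw [map_zero, map_zero]
          exact map_zero _)
        (fun a b h h' v => by
          rw [map_add, map_add]
          exact (map_add _ _ _).trans (congrArg₂ (· + ·) (h v) (h' v)))
        (fun r a h v => by
          rw [map_smul, map_smul]
          exact (map_smul _ r _).trans (congrArg (r • ·) (h v))) p }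
  map_id _ := rfl
  map_comp _ _ := rfl

variable {k C}

/-- Both structure morphisms go from `ℍ_C` to the same endomorphism operad, so they may be compared
on symbols, where `starMap_eq` identifies them. -/
theorem operadToAlg_algToOperad_obj (M : Alg (hyperoperad k C)) : M.toCOperad.toAlg = M := by
  obtain ⟨A, s⟩ := M
  refine congrArg (Alg.mk A) (hyper_hom_ext fun c x i d y f => ?_)
  refine (COperad.lin_toAlg ..).trans (MultilinearMap.ext fun v => ?_)
  refine (Alg.starMap_eq ⟨A, s⟩ i f _ _).symm.trans ?_
  exact congrArg (Alg.starOp ⟨A, s⟩ c x i d y f) (pair_eta v)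

theorem algToOperad_operadToAlg_obj (P : COperad k C) : P.toAlg.toCOperad = P := by
  have h {c : SMon C} {x : C} (i : Fin c.len) {d : SMon C} :
      P.toAlg.toCOperad.comp (x := x) i (d := d) = P.comp i := by
    refine LinearMap.ext₂ fun α β => ?_
    refine (DFunLike.congr_fun (F := Op P.coll _ _) (P.lin_toAlg c x i d (c.col i) (𝟙 _))
      (pair (A := P.coll) (a := (op c, x)) (b := (op d, c.col i)) α β)).trans ?_
    exact congrArg (P.comp i α) (P.coll.act_id β)
  have h' : @COperad.comp k _ C _ P.toAlg.toCOperad = @COperad.comp k _ C _ P := by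
    funext c x i d
    exact h i
  obtain ⟨A, m⟩ := P
  -- The collections coincide definitionally and the axioms are propositions, so only the
  -- compositions have to be compared, which is `h'`.
  change COperad.mk A _ _ _ _ _ = _
  congr 1

/-- A faithful functor detects equality of morphisms up to transport. -/
theorem eq_conj_of_map_heq {D : Type*} [Category D] {E : Type*} [Category E] (U : D ⥤ E)
    [U.Faithful] {X X' Y Y' : D} (hX : X = X') (hY : Y = Y') (f : X ⟶ Y) (f' : X' ⟶ Y')
    (h : U.map f ≍ U.map f') : f = eqToHom hX ≫ f' ≫ eqToHom hY.symm := by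
  subst hX hY
  rw [eqToHom_refl, eqToHom_refl, Category.id_comp, Category.comp_id]
  exact U.map_injective (eq_of_heq h)

instance (P : COperad k C) : (Alg.forget P).Faithful where
  map_injective h := Alg.Hom.ext h

instance : (COperad.forget k C).Faithful where
  map_injective h := COperad.Hom.ext h

end CatOperad

/-! ### The main theorem -/

theorem theoremB3 (k : Type u) [Field k] (C : Type u) [SmallCategory C] :
    (CatOperad.hyperoperad k C).IsBinaryQuadratic ∧
      ∃ (F : CatOperad.Alg (CatOperad.hyperoperad k C) ⥤ CatOperad.COperad k C)
        (G : CatOperad.COperad k C ⥤ CatOperad.Alg (CatOperad.hyperoperad k C)),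
        F ⋙ G = 𝟭 (CatOperad.Alg (CatOperad.hyperoperad k C)) ∧
        G ⋙ F = 𝟭 (CatOperad.COperad k C) ∧
        F ⋙ CatOperad.COperad.forget k C = CatOperad.Alg.forget (CatOperad.hyperoperad k C) := by
  refine ⟨CatOperad.hyperoperad_isBinaryQuadratic k C, CatOperad.algToOperad k C,
    CatOperad.operadToAlg k C, ?_, ?_, rfl⟩
  -- On morphisms both functors keep the underlying natural transformation, so after forgetting, the
  -- two sides are definitionally equal; faithfulness lifts this to equality up to transport.
  · exact CategoryTheory.Functor.ext CatOperad.operadToAlg_algToOperad_obj fun M N f =>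
      CatOperad.eq_conj_of_map_heq (CatOperad.Alg.forget _)
        (CatOperad.operadToAlg_algToOperad_obj M) (CatOperad.operadToAlg_algToOperad_obj N)
        _ _ HEq.rfl
  · exact CategoryTheory.Functor.ext CatOperad.algToOperad_operadToAlg_obj fun P Q f =>
      CatOperad.eq_conj_of_map_heq (CatOperad.COperad.forget k C)
        (CatOperad.algToOperad_operadToAlg_obj P) (CatOperad.algToOperad_operadToAlg_obj Q)
        _ _ HEq.rfl
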